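/- Let $\mathbb K$ be a field of characteristic zero, $G$ a finite group and $H\le G$ a subgroup. For a finite $G$-set $X$, a vector bundle $W$ over $X$ consists of finite-dimensional $\mathbb K$-vector spaces $W_x$ ($x\in X$) and linear maps $g\colon W_x\to W_{gx}$ ($g\in G$), functorial in $g$. Let $K_G^+(X)$ be the semiring of isomorphism classes of vector bundles over $X$ under $\oplus$ and $\otimes$, and $K_G(X)$ its Grothendieck ring; $K_G(\bullet)=R(G)$ is the ring of virtual representations of $G$, and $K_G(G/H)\cong R(H)$ through the fibre at the coset $H$. For a map $f\colon X\to Y$ of finite $G$-sets, $f^*$ is the pullback, $f_*(W)_y=\bigoplus_{f(x)=y}W_x$, and, for $W\in K^+_G(X)$, $f_\sharp(W)_y=\bigotimes_{f(x)=y}W_x$ with $g\cdot\bigotimes w_x=\bigotimes g\cdot w_{g^{-1}x}$. From now on $f\colon G/H\to\bullet$. Let $V$ be the $G$-set of all subsets of $G/H$; for $W\in K_G^+(G/H)$ let $\chi(W)\in K_G^+(V)$ be the bundle with $\chi(W)_C=\bigotimes_{x\in C}W_x$. On $K_G(V)$ let $z\vee t=m_*(p_1^*z\cdot p_2^*t)$,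 where $p_1,p_2,m$ send a pair $(C_1,C_2)$ of disjoint subsets of $G/H$ to $C_1$, $C_2$, $C_1\sqcup C_2$; its unit is the bundle $1_\vee$ that is trivial of rank one over $\emptyset$ and zero elsewhere. The fibre at $C$ of an element of $K_G(V)$ is a virtual representation of $\mathrm{Stab}(C)$. (0) There is a unique map $\chi\colon K_G(G/H)\to K_G(V)$ that extends $\chi$ on actual bundles and satisfies $\chi(W)\vee\chi(-W)=1_\vee$ for $W\in K_G^+(G/H)$ and $\chi(x+y)=\chi(x)\vee\chi(y)$ for all $x,y\in K_G(G/H)$. Put $f_\sharp(x)=\chi(x)_{G/H}\in R(G)$ for $x\in K_G(G/H)$; for actual bundles this is the class of $f_\sharp$ as defined above. Write $\mathcal N_H^G\colon R(H)\to R(G)$ for $f_\sharp$ under $R(H)\cong K_G(G/H)$. (1) If $H\trianglelefteq G$ and $|G:H|$ is an odd prime, then for all $W\in K_G^+(G/H)$ and all $C\subseteq G/H$, $$\chi(-W)_C=(-1)^{|C|}\chi(W)_C\ \text{ in } R(\mathrm{Stab}(C)),\qquad\text{and}\qquad f_\sharp(-W)=-f_\sharp(W).$$ (2) If $|G:H|=2$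 and $t\in G\setminus H$, then for all $W\in K_G^+(G/H)$, $$f_\sharp(-W)=-f_\sharp(W)+f_*(W\otimes W_t)\ \text{ in } R(G),$$ where $W_t$ is the bundle over $G/H$ whose fibre over $xH$ is $W_{xtH}$; in terms of $H$-modules, $f_*(W\otimes W_t)=\mathrm{Ind}_H^G(W\otimes W^t)$ with $W^t$ the conjugate of $W$ by $t$. (3) Suppose $G$ is abelian and $|G:H|=p$ is prime. (a) For every $x\in R(H)$ (with $\chi(x)$ taken under $R(H)\cong K_G(G/H)$) and every $C\subsetneq G/H$, as virtual $H$-modules, $$\chi(x)_C=\prod_{c\in C}x^{t_c}=x^{|C|},$$ where $t_c\in G$ is any representative of $c$ and $x^{t}$ denotes the conjugate of $x$ by $t$. (b) For all $x,y\in R(H)$, $$\mathcal N_H^G(x+y)=\mathcal N_H^G(x)+\mathcal N_H^G(y)+\sum_{i=1}^{p-1}\frac1p\binom pi\,\mathrm{Ind}_H^G(x^iy^{p-i}).$$ -/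

import Mathlib

open scoped Pointwise TensorProduct

universe u v

/-! ## The Grothendieck ring of a commutative semiring -/

namespace Algebra.GrothendieckAddGroup

variable {S T : Type*} [CommSemiring S] [CommSemiring T]

theorem hom_ext {A : Type*} [AddCommGroup A] {f g : GrothendieckAddGroup S →+ A}
    (h : ∀ s, f (of s) = g (of s)) : f = g :=
  lift.symm.injective (by ext s; exact h s)

theorem lift_of {A : Type*} [AddCommGroup A] (f : S →+ A) (s : S) : lift f (of s) = f s :=
  DFunLike.congr_fun (lift.symm_apply_apply f) s

/-- The biadditive extension of the multiplication of `S`. -/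
noncomputable def mulHom :
    GrothendieckAddGroup S →+ GrothendieckAddGroup S →+ GrothendieckAddGroup S :=
  lift
    { toFun := fun s => lift ((of (M := S)).comp (AddMonoidHom.mulLeft s))
      map_zero' := hom_ext fun s => by
        rw [lift_of, AddMonoidHom.comp_apply, AddMonoidHom.coe_mulLeft, zero_mul, map_zero]; rfl
      map_add' := fun a b => hom_ext fun s => by
        rw [AddMonoidHom.add_apply, lift_of, lift_of, lift_of]
        simp only [AddMonoidHom.comp_apply, AddMonoidHom.coe_mulLeft, add_mul, map_add] }

theorem mulHom_of (s t : S) : mulHom (of s) (of t) = of (s * t) := by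
  rw [mulHom, lift_of]
  exact lift_of _ t

theorem mulHom_comm (x y : GrothendieckAddGroup S) : mulHom x y = mulHom y x := by
  have : mulHom (S := S) = (mulHom (S := S)).flip :=
    hom_ext fun s => hom_ext fun t => by
      rw [AddMonoidHom.flip_apply, mulHom_of, mulHom_of, mul_comm]
  exact DFunLike.congr_fun (DFunLike.congr_fun this x) y

theorem mulHom_one (x : GrothendieckAddGroup S) : mulHom (of 1) x = x := by
  have : mulHom (S := S) (of 1) = AddMonoidHom.id _ :=
    hom_ext fun t => by rw [mulHom_of, one_mul]; rfl
  exact DFunLike.congr_fun this x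

theorem mulHom_assoc (x y z : GrothendieckAddGroup S) :
    mulHom (mulHom x y) z = mulHom x (mulHom y z) := by
  have h1 : ∀ (s t : S) (z : GrothendieckAddGroup S),
      mulHom (mulHom (of s) (of t)) z = mulHom (of s) (mulHom (of t) z) := fun s t z =>
    DFunLike.congr_fun (hom_ext (f := mulHom (mulHom (of s) (of t)))
      (g := (mulHom (of s)).comp (mulHom (of t)))
      fun r => by simp only [AddMonoidHom.comp_apply, mulHom_of, mul_assoc]) z
  have h2 : ∀ (s : S) (y z : GrothendieckAddGroup S),
      mulHom (mulHom (of s) y) z = mulHom (of s) (mulHom y z) := fun s y z =>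
    DFunLike.congr_fun (hom_ext (f := (mulHom.flip z).comp (mulHom (of s)))
      (g := (mulHom (of s)).comp (mulHom.flip z))
      fun t => by simpa using h1 s t z) y
  exact DFunLike.congr_fun (hom_ext (f := (mulHom.flip z).comp (mulHom.flip y))
      (g := mulHom.flip (mulHom y z))
      fun s => by simpa using h2 s y z) x

/-- The ring structure on the Grothendieck group of a commutative semiring `S`: the unique one
for which `S → GrothendieckAddGroup S` is a morphism of semirings. -/
noncomputable instance instCommRing : CommRing (GrothendieckAddGroup S) where
  __ := (inferInstance : AddCommGroup (GrothendieckAddGroup S))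
  mul x y := mulHom x y
  one := of 1
  mul_assoc := mulHom_assoc
  one_mul := mulHom_one
  mul_one x := (mulHom_comm x (of 1)).trans (mulHom_one x)
  mul_comm := mulHom_comm
  left_distrib x y z := map_add (mulHom x) y z
  right_distrib x y z := by
    change mulHom (x + y) z = mulHom x z + mulHom y z
    simp
  zero_mul x := by
    change mulHom 0 x = 0
    simp
  mul_zero x := map_zero (mulHom x)

/-- Functoriality for additive maps. -/
noncomputable def mapAdd (f : S →+ T) : GrothendieckAddGroup S →+ GrothendieckAddGroup T :=
  lift ((of (M := T)).comp f)

theorem mapAdd_of (f : S →+ T) (s : S) : mapAdd f (of s) = of (f s) := by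
  exact lift_of _ s

/-- Functoriality for morphisms of semirings. -/
noncomputable def mapRing (f : S →+* T) : GrothendieckAddGroup S →+* GrothendieckAddGroup T where
  __ := mapAdd f.toAddMonoidHom
  map_one' := by
    change mapAdd f.toAddMonoidHom (of 1) = of 1
    rw [mapAdd_of]; exact congrArg _ (map_one f)
  map_mul' x y := by
    change mapAdd f.toAddMonoidHom (mulHom x y) =
      mulHom (mapAdd f.toAddMonoidHom x) (mapAdd f.toAddMonoidHom y)
    have h1 : ∀ (s : S) (y : GrothendieckAddGroup S),
        mapAdd f.toAddMonoidHom (mulHom (of s) y) =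
          mulHom (mapAdd f.toAddMonoidHom (of s)) (mapAdd f.toAddMonoidHom y) := fun s y =>
      DFunLike.congr_fun (hom_ext (f := (mapAdd f.toAddMonoidHom).comp (mulHom (of s)))
        (g := (mulHom (mapAdd f.toAddMonoidHom (of s))).comp (mapAdd f.toAddMonoidHom))
        fun t => by simp only [AddMonoidHom.comp_apply, mapAdd_of, mulHom_of]; simp) y
    exact DFunLike.congr_fun (hom_ext
      (f := (mapAdd f.toAddMonoidHom).comp (mulHom.flip y))
      (g := (mulHom.flip (mapAdd f.toAddMonoidHom y)).comp (mapAdd f.toAddMonoidHom))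
      fun s => by simpa using h1 s y) x

end Algebra.GrothendieckAddGroup

open Algebra (GrothendieckAddGroup)

namespace EquivariantK

/-! ## Equivariant vector bundles over `G`-sets -/

/-- A vector bundle over a `G`-set `X`: a functor from the action groupoid of `X` (an arrow
`x ⟶ y` for each `g` with `g • x = y`) to finite-dimensional `K`-vector spaces. -/
structure Bundle (K : Type u) [Field K] (G : Type v) [Group G] (X : Type v) [MulAction G X] where
  /-- The fibre over a point. -/
  fiber : X → Type (max u v)
  [addCommGroup : ∀ x, AddCommGroup (fiber x)]
  [module : ∀ x, Module K (fiber x)]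
  [finite : ∀ x, Module.Finite K (fiber x)]
  /-- The linear map attached to the arrow `g : x ⟶ y`. -/
  act : ∀ (g : G) {x y : X}, g • x = y → fiber x →ₗ[K] fiber y
  act_one : ∀ {x : X} (h : (1 : G) • x = x) (w : fiber x), act 1 h w = w
  act_mul : ∀ (g' g : G) {x y z : X} (h : g • x = y) (h' : g' • y = z) (h'' : (g' * g) • x = z)
    (w : fiber x), act (g' * g) h'' w = act g' h' (act g h w)

attribute [instance] Bundle.addCommGroup Bundle.module Bundle.finite

namespace Bundle

section

variable {K : Type u} [Field K] {G : Type v} [Group G] {X Y Z : Type v} [MulAction G X]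
  [MulAction G Y]

theorem act_congr (V : Bundle K G X) {g g' : G} (hg : g = g') {x x' y : X} (hx : x = x')
    (h : g • x = y) (h' : g' • x' = y) (w : ∀ z, x = z → V.fiber z) :
    V.act g h (w x rfl) = V.act g' h' (w x' hx) := by
  subst hg; subst hx; rfl

/-- An isomorphism of vector bundles over `X`. -/
structure Iso (V W : Bundle K G X) where
  /-- The isomorphism on fibres. -/
  equiv : ∀ x, V.fiber x ≃ₗ[K] W.fiber x
  comm : ∀ (g : G) {x y : X} (h : g • x = y) (w : V.fiber x),
    equiv y (V.act g h w) = W.act g h (equiv x w)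

/-- The isomorphism relation. -/
instance isoSetoid (K : Type u) [Field K] (G : Type v) [Group G] (X : Type v) [MulAction G X] :
    Setoid (Bundle K G X) where
  r V W := Nonempty (Iso V W)
  iseqv :=
    { refl := fun V => ⟨⟨fun x => LinearEquiv.refl K _, fun _ _ _ _ _ => rfl⟩⟩
      symm := fun ⟨e⟩ => ⟨⟨fun x => (e.equiv x).symm, fun g x y h w => by
        rw [LinearEquiv.symm_apply_eq, e.comm, LinearEquiv.apply_symm_apply]⟩⟩
      trans := fun ⟨e⟩ ⟨e'⟩ => ⟨⟨fun x => (e.equiv x).trans (e'.equiv x), fun g x y h w => by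
        simp [e.comm, e'.comm]⟩⟩ }

/-- The zero bundle. -/
def zero (K : Type u) [Field K] (G : Type v) [Group G] (X : Type v) [MulAction G X] :
    Bundle K G X where
  fiber _ := PUnit
  act _ _ _ _ := 0
  act_one _ _ := rfl
  act_mul _ _ _ _ _ _ _ _ _ := rfl

/-- The trivial line bundle. -/
def one (K : Type u) [Field K] (G : Type v) [Group G] (X : Type v) [MulAction G X] :
    Bundle K G X where
  fiber _ := ULift.{v} K
  act _ _ _ _ := LinearMap.id
  act_one _ _ := rfl
  act_mul _ _ _ _ _ _ _ _ _ := rfl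

/-- The direct sum of two bundles. -/
def add (V W : Bundle K G X) : Bundle K G X where
  fiber x := V.fiber x × W.fiber x
  act g _ _ h := (V.act g h).prodMap (W.act g h)
  act_one h w := by simp [V.act_one, W.act_one]
  act_mul g' g _ _ _ h h' h'' w := by
    simp [V.act_mul g' g h h' h'', W.act_mul g' g h h' h'']

/-- The tensor product of two bundles. -/
noncomputable def mul (V W : Bundle K G X) : Bundle K G X where
  fiber x := V.fiber x ⊗[K] W.fiber x
  act g _ _ h := TensorProduct.map (V.act g h) (W.act g h)
  act_one {x} h w := by
    induction w with
    | zero => simp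
    | tmul a b => simp [V.act_one, W.act_one]
    | add a b ha hb => rw [map_add, ha, hb]
  act_mul g' g _ _ _ h h' h'' w := by
    induction w with
    | zero => simp
    | tmul a b => simp [V.act_mul g' g h h' h'', W.act_mul g' g h h' h'']
    | add a b ha hb => simp only [map_add, ha, hb]

/-- An isomorphism out of a tensor product, with compatibility checked on pure tensors. -/
def Iso.ofMul {V W U : Bundle K G X} (e : ∀ x, (V.mul W).fiber x ≃ₗ[K] U.fiber x)
    (he : ∀ (g : G) {x y : X} (h : g • x = y) (a : V.fiber x) (b : W.fiber x),
      e y (V.act g h a ⊗ₜ[K] W.act g h b) = U.act g h (e x (a ⊗ₜ[K] b))) :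
    Iso (V.mul W) U where
  equiv := e
  comm g x y h w :=
    LinearMap.congr_fun (TensorProduct.ext'
      (g := (e y).toLinearMap ∘ₗ (V.mul W).act g h)
      (h := U.act g h ∘ₗ (e x).toLinearMap) (he g h)) w

/-- The pullback of a bundle along an equivariant map `f : Y → X`, where a group `S` acts on `Y`
and the equivariance is with respect to a morphism `φ : S → G`. -/
def pull {S : Type v} [Group S] [MulAction S Z] (φ : S →* G) (f : Z →ₑ[φ] X)
    (V : Bundle K G X) : Bundle K S Z where
  fiber y := V.fiber (f y)
  act s _ _ h := V.act (φ s) (by rw [← h, map_smulₛₗ])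
  act_one {y} h w := by
    have := V.act_congr (map_one φ) (rfl : f y = f y) (by rw [← map_smulₛₗ, h])
      (one_smul G (f y)) (fun z hz => hz ▸ w)
    exact this.trans (V.act_one _ w)
  act_mul s' s x y z h h' h'' w := by
    have := V.act_congr (map_mul φ s' s) (rfl : f x = f x) (y := f z)
      (by rw [← map_smulₛₗ, h'']) (by rw [← map_mul, ← map_smulₛₗ, h'']) (fun z hz => hz ▸ w)
    exact this.trans (V.act_mul _ _ _ _ _ w)

/-- The bijection between the fibres of an equivariant map induced by `g : y ⟶ z`. -/
def fiberEquiv (f : X →[G] Y) (g : G) {y z : Y} (h : g • y = z) :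
    {x // f x = y} ≃ {x // f x = z} where
  toFun x := ⟨g • x.1, by rw [map_smul, x.2, h]⟩
  invFun x := ⟨g⁻¹ • x.1, by rw [map_smul, x.2, ← h, inv_smul_smul]⟩
  left_inv x := by simp
  right_inv x := by simp

theorem smul_fiberEquiv_symm (f : X →[G] Y) (g : G) {y z : Y} (h : g • y = z)
    (x : {x // f x = z}) : g • ((fiberEquiv f g h).symm x).1 = x.1 := by
  simp [fiberEquiv]

theorem act_fiberEquiv_mul (V : Bundle K G X) (f : X →[G] Y) (g' g : G) {y z t : Y}
    (h : g • y = z) (h' : g' • z = t) (h'' : (g' * g) • y = t)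
    (w : ∀ x : {x // f x = y}, V.fiber x.1) (x : {x // f x = t}) :
    V.act (g' * g) (smul_fiberEquiv_symm f (g' * g) h'' x) (w ((fiberEquiv f (g' * g) h'').symm x))
      = V.act g' (smul_fiberEquiv_symm f g' h' x)
        (V.act g (smul_fiberEquiv_symm f g h ((fiberEquiv f g' h').symm x))
          (w ((fiberEquiv f g h).symm ((fiberEquiv f g' h').symm x)))) := by
  have e : (fiberEquiv f (g' * g) h'').symm x
      = (fiberEquiv f g h).symm ((fiberEquiv f g' h').symm x) := by
    apply Subtype.ext
    simp [fiberEquiv, mul_smul]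
  rw [← V.act_mul g' g _ _ (by rw [← e]; exact smul_fiberEquiv_symm f (g' * g) h'' x)]
  generalize_proofs p1 p2
  revert p1 p2
  rw [e]
  intros; rfl

theorem act_fiberEquiv_one (V : Bundle K G X) (f : X →[G] Y) {y : Y} (h : (1 : G) • y = y)
    (w : ∀ x : {x // f x = y}, V.fiber x.1) (x : {x // f x = y}) :
    V.act 1 (smul_fiberEquiv_symm f 1 h x) (w ((fiberEquiv f 1 h).symm x)) = w x := by
  have e : (fiberEquiv f 1 h).symm x = x := by
    apply Subtype.ext
    simp [fiberEquiv]
  generalize_proofs p1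
  revert p1
  rw [e]
  intro p1
  exact V.act_one p1 _

/-- The induction `f_*`: the fibre over `y` is `⨁_{f x = y} V_x`. -/
def push [Finite X] (f : X →[G] Y) (V : Bundle K G X) : Bundle K G Y where
  fiber y := ∀ x : {x // f x = y}, V.fiber x.1
  act g y z h := LinearMap.pi fun x =>
    V.act g (smul_fiberEquiv_symm f g h x) ∘ₗ LinearMap.proj ((fiberEquiv f g h).symm x)
  act_one h w := by
    funext x
    exact V.act_fiberEquiv_one f h w x
  act_mul g' g _ _ _ h h' h'' w := by
    funext x
    exact V.act_fiberEquiv_mul f g' g h h' h'' w x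

/-- The norm (tensor induction) `f_♯`: the fibre over `y` is `⨂_{f x = y} V_x`, and
`g • ⨂ w_x = ⨂ g • w_{g⁻¹ x}`. -/
noncomputable def norm [Finite X] (f : X →[G] Y) (V : Bundle K G X) : Bundle K G Y where
  fiber y := ⨂[K] x : {x // f x = y}, V.fiber x.1
  act g y z h :=
    PiTensorProduct.map (fun x => V.act g (smul_fiberEquiv_symm f g h x)) ∘ₗ
      (PiTensorProduct.reindex K (fun x : {x // f x = y} => V.fiber x.1)
        (fiberEquiv f g h)).toLinearMap
  act_one {y} h w := by
    induction w using PiTensorProduct.induction_on with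
    | smul_tprod r w =>
      simp only [map_smul, LinearMap.comp_apply, LinearEquiv.coe_coe,
        PiTensorProduct.reindex_tprod, PiTensorProduct.map_tprod, V.act_fiberEquiv_one f h w]
    | add a b ha hb => rw [map_add, ha, hb]
  act_mul g' g _ _ _ h h' h'' w := by
    induction w using PiTensorProduct.induction_on with
    | smul_tprod r w =>
      simp only [map_smul, LinearMap.comp_apply, LinearEquiv.coe_coe,
        PiTensorProduct.reindex_tprod, PiTensorProduct.map_tprod,
        V.act_fiberEquiv_mul f g' g h h' h'' w]
    | add a b ha hb => simp only [map_add, ha, hb]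

theorem norm_act_tprod [Finite X] (V : Bundle K G X) (f : X →[G] Y) (g : G) {y z : Y}
    (h : g • y = z) (w : ∀ x : {x // f x = y}, V.fiber x.1) :
    (V.norm f).act g h (PiTensorProduct.tprod K w) = PiTensorProduct.tprod K fun x =>
      V.act g (smul_fiberEquiv_symm f g h x) (w ((fiberEquiv f g h).symm x)) :=
  (congrArg (PiTensorProduct.map fun x => V.act g (smul_fiberEquiv_symm f g h x))
    (PiTensorProduct.reindex_tprod (R := K) (s := fun x : {x // f x = y} => V.fiber x.1)
      (fiberEquiv f g h) w)).trans (PiTensorProduct.map_tprod _ _)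

/-- An isomorphism out of a norm, with compatibility checked on pure tensors. -/
def Iso.ofNorm [Finite X] {V : Bundle K G X} {U : Bundle K G Y} (f : X →[G] Y)
    (e : ∀ y, (V.norm f).fiber y ≃ₗ[K] U.fiber y)
    (he : ∀ (g : G) {y z : Y} (h : g • y = z) (w : ∀ x : {x // f x = y}, V.fiber x.1),
      e z (PiTensorProduct.tprod K fun x =>
        V.act g (smul_fiberEquiv_symm f g h x) (w ((fiberEquiv f g h).symm x))) =
        U.act g h (e y (PiTensorProduct.tprod K w))) :
    Iso (V.norm f) U where
  equiv := e
  comm g y z h w :=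
    LinearMap.congr_fun (PiTensorProduct.ext
      (φ₁ := (e z).toLinearMap ∘ₗ (V.norm f).act g h)
      (φ₂ := U.act g h ∘ₗ (e y).toLinearMap) (MultilinearMap.ext fun w =>
        (congrArg (e z) (V.norm_act_tprod f g h w)).trans (he g h w))) w

/-- The norms of isomorphic bundles are isomorphic. -/
noncomputable def Iso.norm [Finite X] {V W : Bundle K G X} (f : X →[G] Y) (e : Iso V W) :
    Iso (V.norm f) (W.norm f) :=
  Iso.ofNorm f (fun y => PiTensorProduct.congr fun x => e.equiv x.1) fun g y z h w => by
    have h1 : ∀ (y : Y) (w : ∀ x : {x // f x = y}, V.fiber x.1),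
        (PiTensorProduct.congr (R := K) fun x : {x // f x = y} => e.equiv x.1)
          (PiTensorProduct.tprod K w) = PiTensorProduct.tprod K fun x => e.equiv x.1 (w x) :=
      fun y w => PiTensorProduct.congr_tprod _ w
    have h2 := W.norm_act_tprod f g h fun x => e.equiv x.1 (w x)
    erw [h1, h1, h2]
    exact congrArg _ (funext fun x => e.comm g _ _)

/-- The bundle over `G ⧸ H` attached to a representation `W` of `H` (a bundle over the point):
its fibre over `c` is `c.out ⊗ W`, inside the induced representation `K[G] ⊗_{K[H]} W`, where
`g • (c.out ⊗ w) = d.out ⊗ (d.out⁻¹ * g * c.out) • w` if `g • c = d`. -/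
noncomputable def extend (H : Subgroup G) (W : Bundle K H PUnit.{v + 1}) :
    Bundle K G (G ⧸ H) where
  fiber _ := W.fiber PUnit.unit
  act g c d h := W.act (⟨d.out⁻¹ * g * c.out, by
    rw [mul_assoc, ← QuotientGroup.eq, QuotientGroup.out_eq', ← h]
    conv_lhs => rw [← QuotientGroup.out_eq' c]
    rfl⟩ : H) rfl
  act_one {c} h w := by
    refine Eq.trans ?_ (W.act_one rfl w)
    exact W.act_congr (g := ⟨c.out⁻¹ * 1 * c.out, _⟩) (g' := 1) (Subtype.ext (by simp)) rfl rfl rfl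
      (fun _ _ => w)
  act_mul g' g c d e h h' h'' w := by
    rw [← W.act_mul _ _ rfl rfl rfl]
    exact W.act_congr (g := ⟨e.out⁻¹ * (g' * g) * c.out, _⟩)
      (g' := ⟨e.out⁻¹ * g' * d.out, _⟩ * ⟨d.out⁻¹ * g * c.out, _⟩)
      (Subtype.ext (by simp [mul_assoc])) rfl rfl rfl (fun _ _ => w)

end

end Bundle

/-! ## The semiring `K_G^+(X)` -/

/-- `K_G^+(X)`: isomorphism classes of vector bundles over `X`. -/
def KPlus (K : Type u) [Field K] (G : Type v) [Group G] (X : Type v) [MulAction G X] :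
    Type (max (u + 1) (v + 1)) :=
  Quotient (Bundle.isoSetoid K G X)

namespace KPlus

section

variable {K : Type u} [Field K] {G : Type v} [Group G] {X Y Z : Type v} [MulAction G X]
  [MulAction G Y]

/-- Direct sum on isomorphism classes. -/
instance : Add (KPlus K G X) where
  add := Quotient.map₂ Bundle.add fun _ _ ⟨e⟩ _ _ ⟨e'⟩ =>
    ⟨⟨fun x => (e.equiv x).prodCongr (e'.equiv x), fun g _ _ h w =>
      Prod.ext (e.comm g h w.1) (e'.comm g h w.2)⟩⟩

/-- Tensor product on isomorphism classes. -/
noncomputable instance : Mul (KPlus K G X) where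
  mul := Quotient.map₂ Bundle.mul fun _ _ ⟨e⟩ _ _ ⟨e'⟩ =>
    ⟨Bundle.Iso.ofMul (fun x => TensorProduct.congr (e.equiv x) (e'.equiv x))
      fun g _ _ h a b => congrArg₂ (TensorProduct.tmul K) (e.comm g h a) (e'.comm g h b)⟩

instance : Zero (KPlus K G X) where
  zero := Quotient.mk _ (Bundle.zero K G X)

instance : One (KPlus K G X) where
  one := Quotient.mk _ (Bundle.one K G X)

/-- `K_G^+(X)` is a commutative semiring under direct sum and tensor product. -/
noncomputable instance : CommSemiring (KPlus K G X) where
  add_assoc := by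
    rintro ⟨U⟩ ⟨V⟩ ⟨W⟩
    exact Quotient.sound ⟨⟨fun x => LinearEquiv.prodAssoc K _ _ _, fun _ _ _ _ _ => rfl⟩⟩
  zero_add := by
    rintro ⟨U⟩
    exact Quotient.sound ⟨⟨fun x =>
      (LinearEquiv.uniqueProd : (PUnit.{max u v + 1} × U.fiber x) ≃ₗ[K] U.fiber x), fun _ _ _ _ _ => rfl⟩⟩
  add_zero := by
    rintro ⟨U⟩
    exact Quotient.sound ⟨⟨fun x =>
      (LinearEquiv.prodUnique : (U.fiber x × PUnit.{max u v + 1}) ≃ₗ[K] U.fiber x), fun _ _ _ _ _ => rfl⟩⟩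
  add_comm := by
    rintro ⟨U⟩ ⟨V⟩
    exact Quotient.sound ⟨⟨fun x => LinearEquiv.prodComm K _ _, fun _ _ _ _ _ => rfl⟩⟩
  nsmul := nsmulRec
  mul_assoc := by
    rintro ⟨U⟩ ⟨V⟩ ⟨W⟩
    refine Quotient.sound ⟨⟨fun x => TensorProduct.assoc K _ _ _, fun g x y h w => ?_⟩⟩
    refine LinearMap.congr_fun (f := (TensorProduct.assoc K _ _ _).toLinearMap ∘ₗ
      ((U.mul V).mul W).act g h) (g := (U.mul (V.mul W)).act g h ∘ₗ
        (TensorProduct.assoc K _ _ _).toLinearMap) ?_ w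
    exact TensorProduct.ext_threefold fun _ _ _ => rfl
  one_mul := by
    rintro ⟨U⟩
    exact Quotient.sound ⟨Bundle.Iso.ofMul (fun x => (TensorProduct.congr ULift.moduleEquiv
      (LinearEquiv.refl K _)).trans (TensorProduct.lid K _))
      fun g _ _ h _ _ => (map_smul (U.act g h) _ _).symm⟩
  mul_one := by
    rintro ⟨U⟩
    exact Quotient.sound ⟨Bundle.Iso.ofMul (fun x => (TensorProduct.congr (LinearEquiv.refl K _)
      ULift.moduleEquiv).trans (TensorProduct.rid K _))
      fun g _ _ h _ _ => (map_smul (U.act g h) _ _).symm⟩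
  mul_comm := by
    rintro ⟨U⟩ ⟨V⟩
    exact Quotient.sound ⟨Bundle.Iso.ofMul (fun x => TensorProduct.comm K _ _)
      fun _ _ _ _ _ _ => rfl⟩
  left_distrib := by
    rintro ⟨U⟩ ⟨V⟩ ⟨W⟩
    exact Quotient.sound ⟨Bundle.Iso.ofMul (fun x => TensorProduct.prodRight K K _ _ _)
      fun _ _ _ _ _ _ => rfl⟩
  right_distrib := by
    rintro ⟨U⟩ ⟨V⟩ ⟨W⟩
    exact Quotient.sound ⟨Bundle.Iso.ofMul (fun x => TensorProduct.prodLeft K K _ _ _)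
      fun _ _ _ _ _ _ => rfl⟩
  zero_mul := by
    rintro ⟨U⟩
    refine Quotient.sound ⟨⟨fun x =>
      haveI : Subsingleton ((Bundle.zero K G X).fiber x) := inferInstanceAs (Subsingleton PUnit)
      haveI : Subsingleton (((Bundle.zero K G X).mul U).fiber x) :=
        inferInstanceAs (Subsingleton ((Bundle.zero K G X).fiber x ⊗[K] U.fiber x))
      { (0 : ((Bundle.zero K G X).mul U).fiber x →ₗ[K] (Bundle.zero K G X).fiber x) with
        invFun := 0
        left_inv := fun _ => Subsingleton.elim _ _
        right_inv := fun _ => rfl }, fun g x y h w => rfl⟩⟩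
  mul_zero := by
    rintro ⟨U⟩
    refine Quotient.sound ⟨⟨fun x =>
      haveI : Subsingleton ((Bundle.zero K G X).fiber x) := inferInstanceAs (Subsingleton PUnit)
      haveI : Subsingleton ((U.mul (Bundle.zero K G X)).fiber x) :=
        inferInstanceAs (Subsingleton (U.fiber x ⊗[K] (Bundle.zero K G X).fiber x))
      { (0 : (U.mul (Bundle.zero K G X)).fiber x →ₗ[K] (Bundle.zero K G X).fiber x) with
        invFun := 0
        left_inv := fun _ => Subsingleton.elim _ _
        right_inv := fun _ => rfl }, fun g x y h w => rfl⟩⟩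

/-- Pullback on isomorphism classes. -/
noncomputable def pull {S : Type v} [Group S] [MulAction S Z] (φ : S →* G) (f : Z →ₑ[φ] X) :
    KPlus K G X →+* KPlus K S Z where
  toFun := Quotient.map (Bundle.pull φ f) fun _ _ ⟨e⟩ =>
    ⟨⟨fun z => e.equiv (f z), fun s _ _ _ w => e.comm (φ s) _ w⟩⟩
  map_one' := rfl
  map_zero' := rfl
  map_mul' := by rintro ⟨U⟩ ⟨V⟩; rfl
  map_add' := by rintro ⟨U⟩ ⟨V⟩; rfl

/-- The induction `f_*` on isomorphism classes. -/
noncomputable def push [Finite X] (f : X →[G] Y) : KPlus K G X →+ KPlus K G Y where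
  toFun := Quotient.map (Bundle.push f) fun _ _ ⟨e⟩ =>
    ⟨⟨fun y => LinearEquiv.piCongrRight fun x => e.equiv x.1, fun g y z h w => by
      funext x
      exact e.comm g _ _⟩⟩
  map_zero' := Quotient.sound ⟨⟨fun y =>
    { (0 : ((Bundle.zero K G X).push f).fiber y →ₗ[K] (Bundle.zero K G Y).fiber y) with
      invFun := 0
      left_inv := fun _ => rfl
      right_inv := fun _ => rfl }, fun g x y h w => rfl⟩⟩
  map_add' := by
    rintro ⟨U⟩ ⟨V⟩
    exact Quotient.sound ⟨⟨fun y =>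
      { toFun := fun w => (fun x => (w x).1, fun x => (w x).2)
        invFun := fun w x => (w.1 x, w.2 x)
        map_add' := fun _ _ => rfl
        map_smul' := fun _ _ => rfl
        left_inv := fun _ => rfl
        right_inv := fun _ => rfl }, fun g x y h w => rfl⟩⟩

/-- The norm (tensor induction) `f_♯` on isomorphism classes. -/
noncomputable def norm [Finite X] (f : X →[G] Y) : KPlus K G X → KPlus K G Y :=
  Quotient.map (Bundle.norm f) fun _ _ ⟨e⟩ => ⟨e.norm f⟩

/-- The identification `R^+(H) → K_G^+(G ⧸ H)`. -/
noncomputable def extend (H : Subgroup G) : KPlus K H PUnit.{v + 1} →+ KPlus K G (G ⧸ H) where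
  toFun := Quotient.map (Bundle.extend H) fun _ _ ⟨e⟩ =>
    ⟨⟨fun _ => e.equiv _, fun _ _ _ _ w => e.comm _ _ w⟩⟩
  map_zero' := rfl
  map_add' := by rintro ⟨U⟩ ⟨V⟩; rfl

end

end KPlus

/-! ## The ring `K_G(X)` of virtual bundles -/

/-- `K_G(X)`: the Grothendieck ring of virtual vector bundles over `X`. -/
abbrev KG (K : Type u) [Field K] (G : Type v) [Group G] (X : Type v) [MulAction G X] :
    Type (max (u + 1) (v + 1)) :=
  GrothendieckAddGroup (KPlus K G X)

/-- `R(G)`: the ring of virtual characters (virtual representations) of `G` over `K`. -/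
abbrev RepRing (K : Type u) [Field K] (G : Type v) [Group G] : Type (max (u + 1) (v + 1)) :=
  KG K G PUnit.{v + 1}

section

variable {K : Type u} [Field K] {G : Type v} [Group G] {X Y Z : Type v} [MulAction G X]
  [MulAction G Y]

/-- The class in `K_G(X)` of an actual bundle. -/
noncomputable def cls (W : KPlus K G X) : KG K G X := GrothendieckAddGroup.of W

/-- Pullback of virtual bundles, with change of group. -/
noncomputable def pull {S : Type v} [Group S] [MulAction S Z] (φ : S →* G) (f : Z →ₑ[φ] X) :
    KG K G X →+* KG K S Z :=
  GrothendieckAddGroup.mapRing (KPlus.pull φ f)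

/-- The restriction `f^*` of virtual bundles. -/
noncomputable def res (f : X →[G] Y) : KG K G Y →+* KG K G X :=
  pull (MonoidHom.id G) f

/-- The induction `f_*` of virtual bundles. -/
noncomputable def push [Finite X] (f : X →[G] Y) : KG K G X →+ KG K G Y :=
  GrothendieckAddGroup.mapAdd (KPlus.push f)

/-- The map to the point. -/
def toPoint (G : Type v) [Group G] (X : Type v) [MulAction G X] : X →[G] PUnit.{v + 1} where
  toFun _ := PUnit.unit
  map_smul' _ _ := rfl

/-- The fibre at `x` of a virtual bundle, as a virtual representation of a subgroup `S` of the
stabilizer of `x`. -/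
noncomputable def fiberAt (S : Subgroup G) (x : X) (h : S ≤ MulAction.stabilizer G x) :
    KG K G X →+* RepRing K S :=
  pull S.subtype
    { toFun := fun _ : PUnit.{v + 1} => x
      map_smul' := fun s _ => (MulAction.mem_stabilizer_iff.mp (h s.2)).symm }

end

/-! ## The operation `∨` and the map `χ` -/

section

variable {G : Type v} [Group G] (H : Subgroup G)

/-- The `G`-set of pairs `(x, C)` with `x ∈ C ⊆ G ⧸ H`. -/
def Pointed : Type v := {q : (G ⧸ H) × Set (G ⧸ H) // q.1 ∈ q.2}

instance : MulAction G (Pointed H) where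
  smul g q := ⟨g • q.1, Set.smul_mem_smul_set q.2⟩
  one_smul q := Subtype.ext (one_smul G q.1)
  mul_smul g h q := Subtype.ext (mul_smul g h q.1)

/-- The `G`-set of pairs of disjoint subsets of `G ⧸ H`. -/
def DisjPairs : Type v := {q : Set (G ⧸ H) × Set (G ⧸ H) // Disjoint q.1 q.2}

instance : MulAction G (DisjPairs H) where
  smul g q := ⟨g • q.1, (Set.disjoint_image_iff (MulAction.injective g)).mpr q.2⟩
  one_smul q := Subtype.ext (one_smul G q.1)
  mul_smul g h q := Subtype.ext (mul_smul g h q.1)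

instance [Finite G] : Finite (Pointed H) :=
  inferInstanceAs (Finite {q : (G ⧸ H) × Set (G ⧸ H) // q.1 ∈ q.2})

instance [Finite G] : Finite (DisjPairs H) :=
  inferInstanceAs (Finite {q : Set (G ⧸ H) × Set (G ⧸ H) // Disjoint q.1 q.2})

/-- `(x, C) ↦ x`. -/
def Pointed.point : Pointed H →[G] G ⧸ H where
  toFun q := q.1.1
  map_smul' _ _ := rfl

/-- `(x, C) ↦ C`. -/
def Pointed.set : Pointed H →[G] Set (G ⧸ H) where
  toFun q := q.1.2
  map_smul' _ _ := rfl

/-- `(C₁, C₂) ↦ C₁`. -/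
def DisjPairs.fst : DisjPairs H →[G] Set (G ⧸ H) where
  toFun q := q.1.1
  map_smul' _ _ := rfl

/-- `(C₁, C₂) ↦ C₂`. -/
def DisjPairs.snd : DisjPairs H →[G] Set (G ⧸ H) where
  toFun q := q.1.2
  map_smul' _ _ := rfl

/-- `(C₁, C₂) ↦ C₁ ⊔ C₂`. -/
def DisjPairs.union : DisjPairs H →[G] Set (G ⧸ H) where
  toFun q := q.1.1 ∪ q.1.2
  map_smul' _ _ := Set.smul_set_union.symm

/-- The inclusion of the fixed point `∅` of the `G`-set of subsets of `G ⧸ H`. -/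
def emptyPoint : PUnit.{v + 1} →[G] Set (G ⧸ H) where
  toFun _ := ∅
  map_smul' _ _ := Set.smul_set_empty.symm

/-- The inclusion of the fixed point `G ⧸ H` of the `G`-set of subsets of `G ⧸ H`. -/
def fullPoint : PUnit.{v + 1} →[G] Set (G ⧸ H) where
  toFun _ := Set.univ
  map_smul' _ _ := Set.smul_set_univ.symm

variable {K : Type u} [Field K] [Finite G]

/-- `z ∨ t = m_* (p₁^* z · p₂^* t)`. -/
noncomputable def vee (z t : KG K G (Set (G ⧸ H))) : KG K G (Set (G ⧸ H)) :=
  push (DisjPairs.union H) (res (DisjPairs.fst H) z * res (DisjPairs.snd H) t)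

/-- The unit for `∨`: the trivial representation over `∅`, and zero elsewhere. -/
noncomputable def veeOne : KG K G (Set (G ⧸ H)) := push (emptyPoint H) 1

/-- `χ(W)` for an actual bundle `W`: its fibre over `C` is `⨂_{x ∈ C} W_x`. -/
noncomputable def chiPlus (W : KPlus K G (G ⧸ H)) : KPlus K G (Set (G ⧸ H)) :=
  KPlus.norm (Pointed.set H) (KPlus.pull (MonoidHom.id G) (Pointed.point H) W)

/-- `c` extends `χ` to virtual bundles: `c(-W)` is inverse to `χ(W)` for `∨`, and `c` takes sums
to `∨`. -/
structure IsChiExtension (c : KG K G (G ⧸ H) → KG K G (Set (G ⧸ H))) : Prop where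
  cls : ∀ W, c (cls W) = cls (chiPlus H W)
  neg : ∀ W, vee H (EquivariantK.cls (chiPlus H W)) (c (-EquivariantK.cls W)) = veeOne H
  add : ∀ x y, c (x + y) = vee H (c x) (c y)

/-- The extension of `χ` to virtual bundles (the map singled out by
`IsChiExtension`, which exists and is unique). -/
noncomputable def chi : KG K G (G ⧸ H) → KG K G (Set (G ⧸ H)) :=
  Classical.epsilon (IsChiExtension H)

/-- The norm `f_♯ : K_G^+(G ⧸ H) → K_G^+(•)` of actual bundles. -/
noncomputable def normPlus (W : KPlus K G (G ⧸ H)) : KPlus K G PUnit.{v + 1} :=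
  KPlus.norm (toPoint G (G ⧸ H)) W

/-- The norm `f_♯ : K_G(G ⧸ H) → K_G(•)` of virtual bundles: the fibre of `χ` over `G ⧸ H`. -/
noncomputable def norm (x : KG K G (G ⧸ H)) : RepRing K G :=
  res (fullPoint H) (chi H x)

/-- The induction `f_* : K_G(G ⧸ H) → K_G(•)`. -/
noncomputable def ind : KG K G (G ⧸ H) →+ RepRing K G :=
  push (toPoint G (G ⧸ H))

/-- The identification `R(H) → K_G(G ⧸ H)`. -/
noncomputable def ofRep : RepRing K H →+ KG K G (G ⧸ H) :=
  GrothendieckAddGroup.mapAdd (KPlus.extend H)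

/-- The norm `N_H^G : R(H) → R(G)` of virtual representations. -/
noncomputable def repNorm (x : RepRing K H) : RepRing K G := norm H (ofRep H x)

/-- The induction `Ind_H^G : R(H) → R(G)` of virtual representations. -/
noncomputable def repInd (x : RepRing K H) : RepRing K G := ind H (ofRep H x)

end

/-! ## Conjugates, for a normal subgroup -/

section

variable {G : Type v} [Group G] {H : Subgroup G}

theorem normal_of_comm (h : ∀ a b : G, a * b = b * a) : H.Normal :=
  ⟨fun n hn g => by rwa [h g n, mul_inv_cancel_right]⟩

theorem smul_coset_eq (hH : H.Normal) {h : G} (hh : h ∈ H) (c : G ⧸ H) : h • c = c := by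
  induction c using QuotientGroup.induction_on with
  | H a =>
    rw [MulAction.Quotient.smul_coe, smul_eq_mul, eq_comm, QuotientGroup.eq, ← mul_assoc]
    simpa using hH.conj_mem h hh a⁻¹

theorem le_stabilizer_set (hH : H.Normal) (C : Set (G ⧸ H)) :
    H ≤ MulAction.stabilizer G C := by
  intro h hh
  rw [MulAction.mem_stabilizer_iff]
  change (fun c => h • c) '' C = C
  simp [smul_coset_eq hH hh]

/-- The equivariant map `gH ↦ gtH` from `G ⧸ H` to itself. -/
def rightMul (hH : H.Normal) (t : G) : (G ⧸ H) →[G] (G ⧸ H) where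
  toFun c := c * (t : G ⧸ H)
  map_smul' g c := by
    induction c using QuotientGroup.induction_on with
    | H a =>
      change ((g * a * t : G) : G ⧸ H) = ((g * (a * t) : G) : G ⧸ H)
      rw [mul_assoc]

variable {K : Type u} [Field K]

/-- The conjugate bundle `W_t`, whose fibre over `xH` is `W_{xtH}`. -/
noncomputable def translate (hH : H.Normal) (t : G) : KPlus K G (G ⧸ H) →+* KPlus K G (G ⧸ H) :=
  KPlus.pull (MonoidHom.id G) (rightMul hH t)

/-- The conjugate `x^t` of a virtual representation of `H`: `h` acts as `t⁻¹ * h * t` on `x`. -/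
noncomputable def conj (hH : H.Normal) (t : G) : RepRing K H →+* RepRing K H :=
  pull (MulAut.conjNormal t⁻¹ : MulAut H).toMonoidHom
    { toFun := fun c : PUnit.{v + 1} => c
      map_smul' := fun _ _ => rfl }

end

end EquivariantK

/-! A virtual bundle over a finite `G`-set is determined by its characters, the traces of `g` on the
fibres at the points fixed by `g` (`ext_chr`), so every identity can be checked on characters. This
rests on a Maschke argument: equal characters give spaces of morphisms of equal dimension, hence a
nonzero morphism, which is split off by averaging.

Over the set of subsets of `G ⧸ H`, and for fixed `g`, the characters form a function of `C`,
extended by zero to the `C` with `g • C ≠ C`. In this form `∨` becomes convolution over ordered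
partitions `C = D ⊔ E` (`setChr_vee`), and `χ` takes direct sums to convolution products, because
choosing a basis vector of `V ⊕ W` at each point of `C` splits `C` in two
(`cyclicSum_blockDiagonal`). The value at `∅` of `χ(W)` is 1 and functions vanishing at `∅` are
nilpotent, so `χ(W)` is invertible; the universal property of the Grothendieck group then yields the
extension, and cancellation its uniqueness.

Let `H` be normal of prime index `p`. An element of `H` fixes every coset, and there the character
of `χ(x)` at `C` is the product over `c ∈ C` of those of `x` (`setChr_chi_of_trivial`). An element
outside `H` permutes the cosets transitively, its only invariant subsets are `∅` and everything, and
convolution at the full set collapses to a sum: the norm is additive there (`setChr_chi_add_univ`),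
while induced characters vanish. The three formulas follow by comparing these two cases. The sign
`(-1) ^ |C|` on `H` agrees with the sign `-1` outside `H` at the full set when `p` is odd; for `p =
2` the discrepancy on `H` is the induced term; for abelian `G` the correction is the middle part of
the binomial expansion. -/

/-! ### Preliminaries on Grothendieck rings, traces and averages. -/

namespace Algebra.GrothendieckAddGroup

variable {S R : Type*} [CommSemiring S] [CommRing R]

theorem exists_of_sub_of (x : GrothendieckAddGroup S) : ∃ s t : S, x = of s - of t := by
  obtain ⟨⟨s, t⟩, h⟩ := (AddLocalization.addMonoidOf (⊤ : AddSubmonoid S)).surj x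
  exact ⟨s, t, eq_sub_of_add_eq h⟩

/-- The extension of a morphism of semirings to the Grothendieck ring. -/
noncomputable def liftRing (f : S →+* R) : GrothendieckAddGroup S →+* R where
  __ := lift f.toAddMonoidHom
  map_one' := (lift_of f.toAddMonoidHom 1).trans (map_one f)
  map_mul' x y := by
    change lift f.toAddMonoidHom (mulHom x y) = lift f.toAddMonoidHom x * lift f.toAddMonoidHom y
    obtain ⟨a, b, rfl⟩ := exists_of_sub_of x
    obtain ⟨c, d, rfl⟩ := exists_of_sub_of y
    simp only [map_sub, AddMonoidHom.sub_apply, mulHom_of, lift_of]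
    simp only [RingHom.toAddMonoidHom_eq_coe, AddMonoidHom.coe_coe, map_mul]
    ring

theorem liftRing_of (f : S →+* R) (s : S) : liftRing f (of s) = f s :=
  lift_of f.toAddMonoidHom s

end Algebra.GrothendieckAddGroup

/-- The identity is the sum of the operators that project to a factor and include it back; cyclicity
of the trace does the rest. -/
theorem LinearMap.trace_pi_eq_sum {K ι : Type*} [Field K] [Fintype ι] [DecidableEq ι]
    {V : ι → Type*} [∀ i, AddCommGroup (V i)] [∀ i, Module K (V i)] [∀ i, Module.Finite K (V i)]
    (T : (∀ i, V i) →ₗ[K] ∀ i, V i) :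
    LinearMap.trace K _ T =
      ∑ i, LinearMap.trace K (V i) (LinearMap.proj i ∘ₗ T ∘ₗ LinearMap.single K V i) := by
  have h : T = ∑ i, (T ∘ₗ LinearMap.single K V i) ∘ₗ LinearMap.proj i := by
    refine LinearMap.ext fun w => ?_
    rw [LinearMap.sum_apply]
    simp only [LinearMap.comp_apply, LinearMap.proj_apply, LinearMap.coe_single]
    rw [← map_sum, Finset.univ_sum_single]
  conv_lhs => rw [h]
  rw [map_sum]
  exact Finset.sum_congr rfl fun i _ => LinearMap.trace_comp_comm' _ _

namespace Representation

variable {K G V : Type*} [Field K] [CharZero K] [Group G] [Fintype G] [AddCommGroup V] [Module K V]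
  (ρ : Representation K G V)

/-- The averaging operator is a projection onto the invariants, so its trace is their dimension. -/
theorem finrank_invariants_mul_card [Module.Finite K V] :
    (Module.finrank K ρ.invariants : K) * Fintype.card G =
      ∑ g : G, LinearMap.trace K V (ρ g) := by
  have hG : (Fintype.card G : K) ≠ 0 := by simp
  let _ : Invertible (Fintype.card G : K) := invertibleOfNonzero hG
  rw [← ρ.isProj_averageMap.trace]
  simp only [averageMap, GroupAlgebra.average, map_smul, map_sum,
    asAlgebraHom_of, smul_eq_mul]
  rw [mul_comm, ← mul_assoc, mul_invOf_self, one_mul]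

theorem exists_invariant_average (v : V) :
    ∃ w ∈ ρ.invariants, w = (Fintype.card G : K)⁻¹ • ∑ g : G, ρ g v := by
  have hG : (Fintype.card G : K) ≠ 0 := by simp
  let _ : Invertible (Fintype.card G : K) := invertibleOfNonzero hG
  refine ⟨_, ρ.averageMap_invariant v, ?_⟩
  simp [GroupAlgebra.average]

end Representation

/-! ### Characters of bundles. -/

namespace EquivariantK

namespace Bundle

variable {K : Type u} [Field K] {G : Type v} [Group G] {X Y Z : Type v} [MulAction G X]
  [MulAction G Y]

/-- The value at `g` of the character of the fibre at a fixed point `x` of `g`. -/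
noncomputable def chr (V : Bundle K G X) {g : G} {x : X} (h : g • x = x) : K :=
  LinearMap.trace K (V.fiber x) (V.act g h)

theorem Iso.chr_eq {V W : Bundle K G X} (e : Iso V W) {g : G} {x : X} (h : g • x = x) :
    V.chr h = W.chr h := by
  rw [chr, chr, ← LinearMap.trace_conj' (V.act g h) (e.equiv x)]
  congr 1
  refine LinearMap.ext fun w => ?_
  rw [LinearEquiv.conj_apply_apply, e.comm, LinearEquiv.apply_symm_apply]

theorem chr_add (V W : Bundle K G X) {g : G} {x : X} (h : g • x = x) :
    (V.add W).chr h = V.chr h + W.chr h :=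
  LinearMap.trace_prodMap' _ _

theorem chr_mul (V W : Bundle K G X) {g : G} {x : X} (h : g • x = x) :
    (V.mul W).chr h = V.chr h * W.chr h :=
  LinearMap.trace_tensorProduct' _ _

theorem chr_zero {g : G} {x : X} (h : g • x = x) : (zero K G X).chr h = 0 :=
  map_zero (LinearMap.trace K PUnit.{max u v + 1})

theorem chr_one {g : G} {x : X} (h : g • x = x) : (one K G X).chr h = 1 := by
  refine (LinearMap.trace_id K (ULift.{v} K)).trans ?_
  simp

-- The element `g` permutes the summands `V_x`, so only those at fixed points meet the diagonal.
open Classical in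
theorem chr_push [Finite X] [Fintype X] (V : Bundle K G X) (f : X →[G] Y) {g : G} {y : Y}
    (h : g • y = y) :
    (V.push f).chr h = ∑ x : X, if hx : f x = y ∧ g • x = x then V.chr hx.2 else 0 := by
  refine (LinearMap.trace_pi_eq_sum (V := fun x : {x // f x = y} => V.fiber x.1)
    ((V.push f).act g h)).trans ?_
  rw [← Finset.sum_subset (Finset.subset_univ (Finset.univ.filter fun x => f x = y))
    (fun x _ hx => dif_neg fun hx' => hx (by simpa using hx'.1)),
    Finset.sum_subtype (p := fun x => f x = y) _ (by simp)]
  refine Finset.sum_congr rfl fun x _ => ?_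
  -- The point `x'`, later the preimage of `x` under `g`, is left variable so that it can be
  -- substituted in the dependent types.
  have key : ∀ x' : {x // f x = y}, ∀ h' : g • x'.1 = x.1, ∀ w : V.fiber x.1,
      V.act g h' ((Pi.single x w : ∀ x : {x // f x = y}, V.fiber x.1) x') =
        if hx : g • x.1 = x.1 then V.act g hx w else 0 := by
    intro x' h' w
    by_cases hx : x' = x
    · subst hx
      rw [dif_pos h', Pi.single_eq_same]
    · rw [Pi.single_eq_of_ne hx, map_zero, dif_neg]
      intro h2
      exact hx (Subtype.ext (MulAction.injective g (h'.trans h2.symm)))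
  by_cases hx : g • x.1 = x.1
  · rw [dif_pos ⟨x.2, hx⟩]
    refine congrArg _ (LinearMap.ext fun w => ?_)
    refine (key _ (smul_fiberEquiv_symm f g h x) w).trans (dif_pos hx)
  · rw [dif_neg fun h => hx h.2]
    refine (congrArg _ (LinearMap.ext fun w => ?_)).trans (map_zero _)
    refine (key _ (smul_fiberEquiv_symm f g h x) w).trans (dif_neg hx)

/-! ### The bundle of homomorphisms -/

theorem act_inv_act (V : Bundle K G X) {g : G} {x y : X} (h : g • x = y) (h' : g⁻¹ • y = x)
    (w : V.fiber x) : V.act g⁻¹ h' (V.act g h w) = w := by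
  rw [← V.act_mul g⁻¹ g h h' (by rw [inv_mul_cancel, one_smul])]
  exact (V.act_congr (inv_mul_cancel g) (rfl : x = x) _ (one_smul G x) (fun z hz => hz ▸ w)).trans
    (V.act_one _ w)

theorem act_act_inv (V : Bundle K G X) {g : G} {x y : X} (h : g • x = y) (h' : g⁻¹ • y = x)
    (w : V.fiber y) : V.act g h (V.act g⁻¹ h' w) = w := by
  rw [← V.act_mul g g⁻¹ h' h (by rw [mul_inv_cancel, one_smul])]
  exact (V.act_congr (mul_inv_cancel g) (rfl : y = y) _ (one_smul G y) (fun z hz => hz ▸ w)).trans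
    (V.act_one _ w)

theorem inv_smul_of_smul_eq {g : G} {x y : X} (h : g • x = y) : g⁻¹ • y = x := by
  rw [← h, inv_smul_smul]

/-- The bundle of homomorphisms between two bundles. -/
def hom (V W : Bundle K G X) : Bundle K G X where
  fiber x := V.fiber x →ₗ[K] W.fiber x
  act g x y h :=
    { toFun := fun φ => W.act g h ∘ₗ φ ∘ₗ V.act g⁻¹ (inv_smul_of_smul_eq h)
      map_add' := fun φ ψ => by
        rw [LinearMap.add_comp, LinearMap.comp_add]
      map_smul' := fun r φ => by
        rw [LinearMap.smul_comp, LinearMap.comp_smul]; rfl }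
  act_one {x} h φ := by
    refine LinearMap.ext fun w => ?_
    change W.act 1 h (φ (V.act 1⁻¹ _ w)) = φ w
    rw [W.act_one]
    refine congrArg φ ?_
    exact (V.act_congr inv_one (rfl : x = x) _ h (fun z hz => hz ▸ w)).trans (V.act_one _ w)
  act_mul g' g x y z h h' h'' φ := by
    refine LinearMap.ext fun w => ?_
    change W.act (g' * g) h'' (φ (V.act (g' * g)⁻¹ _ w)) =
      W.act g' h' (W.act g h (φ (V.act g⁻¹ _ (V.act g'⁻¹ _ w))))
    rw [W.act_mul g' g h h' h'', ← V.act_mul g⁻¹ g'⁻¹ (inv_smul_of_smul_eq h')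
      (inv_smul_of_smul_eq h) (by rw [← mul_inv_rev]; exact inv_smul_of_smul_eq h'')]
    refine congrArg _ (congrArg _ (congrArg φ ?_))
    exact V.act_congr (mul_inv_rev g' g) (rfl : z = z) _ _ (fun z hz => hz ▸ w)

/-- Under `Hom(V, W) ≅ V* ⊗ W` the operator `φ ↦ b ∘ φ ∘ a` becomes the tensor product of the
transpose of `a` with `b`. -/
theorem trace_conj_hom {V W : Type*} [AddCommGroup V] [Module K V] [Module.Finite K V]
    [AddCommGroup W] [Module K W] [Module.Finite K W] (a : V →ₗ[K] V) (b : W →ₗ[K] W) :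
    LinearMap.trace K (V →ₗ[K] W) (LinearMap.lcomp K W a ∘ₗ LinearMap.llcomp K V W W b) =
      LinearMap.trace K V a * LinearMap.trace K W b := by
  have h := LinearMap.trace_conj' (R := K) (M := Module.Dual K V ⊗[K] W) (N := V →ₗ[K] W)
    (TensorProduct.map (Module.Dual.transpose (R := K) a) b) (dualTensorHomEquiv K V W)
  rw [LinearMap.trace_tensorProduct', LinearMap.trace_transpose'] at h
  rw [← h]
  refine congrArg _ ?_
  refine LinearMap.ext fun φ => ?_
  obtain ⟨t, rfl⟩ := (dualTensorHomEquiv K V W).surjective φ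
  rw [LinearEquiv.conj_apply_apply, LinearEquiv.symm_apply_apply]
  induction t with
  | zero => simp
  | add x y hx hy => simp only [map_add, hx, hy]
  | tmul x y =>
    ext w
    simp [Module.Dual.transpose_apply]

theorem chr_hom (V W : Bundle K G X) {g : G} {x : X} (h : g • x = x) :
    (V.hom W).chr h = V.chr (inv_smul_of_smul_eq h) * W.chr h :=
  trace_conj_hom _ _

/-! ### Morphisms of bundles and averaging over the group. -/

/-- A morphism of bundles. -/
structure Hom (V W : Bundle K G X) where
  /-- The maps on fibres. -/
  map : ∀ x, V.fiber x →ₗ[K] W.fiber x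
  comm : ∀ (g : G) {x y : X} (h : g • x = y) (w : V.fiber x),
    map y (V.act g h w) = W.act g h (map x w)

/-- A bundle over the point as a representation. -/
def toRep (V : Bundle K G PUnit.{v + 1}) : Representation K G (V.fiber PUnit.unit) where
  toFun g := V.act g rfl
  map_one' := LinearMap.ext fun w => V.act_one _ w
  map_mul' g g' := LinearMap.ext fun w => V.act_mul g g' _ _ _ w

/-- The representation on families of linear maps between the fibres. -/
def homRep [Finite X] (V W : Bundle K G X) :
    Representation K G (((V.hom W).push (toPoint G X)).fiber PUnit.unit) :=
  toRep ((V.hom W).push (toPoint G X))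

/-- The component at `x` of a family of linear maps. -/
def comp [Finite X] {V W : Bundle K G X} (x : X) :
    ((V.hom W).push (toPoint G X)).fiber PUnit.unit →ₗ[K] (V.fiber x →ₗ[K] W.fiber x) :=
  LinearMap.proj (φ := fun x : {x // toPoint G X x = PUnit.unit} => (V.hom W).fiber x.1) ⟨x, rfl⟩

theorem comp_homRep [Finite X] {V W : Bundle K G X}
    (φ : ((V.hom W).push (toPoint G X)).fiber PUnit.unit) (g : G) {x y : X} (h : g • x = y)
    (w : V.fiber y) :
    comp y (V.homRep W g φ) w = W.act g h (comp x φ (V.act g⁻¹ (inv_smul_of_smul_eq h) w)) := by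
  obtain rfl := inv_smul_of_smul_eq h
  rfl

/-- The morphism attached to an invariant family of linear maps. -/
def Hom.ofInvariant [Finite X] {V W : Bundle K G X}
    (φ : ((V.hom W).push (toPoint G X)).fiber PUnit.unit) (hφ : φ ∈ (V.homRep W).invariants) :
    Hom V W where
  map x := comp x φ
  comm g x y h w := by
    conv_lhs => rw [← hφ g]
    rw [comp_homRep φ g h, act_inv_act]

theorem Hom.mem_invariants [Finite X] {V W : Bundle K G X} (f : Hom V W) :
    (fun x => f.map x.1 : ((V.hom W).push (toPoint G X)).fiber PUnit.unit) ∈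
      (V.homRep W).invariants := by
  intro g
  funext x
  refine LinearMap.ext fun w => ?_
  refine (comp_homRep _ g (smul_inv_smul g x.1) w).trans ?_
  refine (f.comm g _ _).symm.trans ?_
  rw [act_act_inv]

theorem finrank_invariants_homRep [Finite X] [Fintype G] [CharZero K] (V W : Bundle K G X) :
    (Module.finrank K (V.homRep W).invariants : K) * Fintype.card G =
      ∑ g : G, ((V.hom W).push (toPoint G X)).chr (g := g) (x := PUnit.unit) rfl :=
  (V.homRep W).finrank_invariants_mul_card

/-- The dimension of the space of morphisms is an average of products of characters, so it sees `W`
only through its characters. This is what produces a nonzero morphism out of an equality of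
characters. -/
theorem finrank_invariants_homRep_congr [Finite X] [Finite G] [CharZero K] (V W W' : Bundle K G X)
    (hW : ∀ (g : G) (x : X) (h : g • x = x), W.chr h = W'.chr h) :
    Module.finrank K (V.homRep W).invariants = Module.finrank K (V.homRep W').invariants := by
  have := Fintype.ofFinite G
  have := Fintype.ofFinite X
  have hG : (Fintype.card G : K) ≠ 0 := by simp
  have h : (Module.finrank K (V.homRep W).invariants : K) =
      Module.finrank K (V.homRep W').invariants := by
    refine mul_right_cancel₀ hG ?_
    rw [finrank_invariants_homRep, finrank_invariants_homRep]
    refine Finset.sum_congr rfl fun g _ => ?_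
    rw [chr_push, chr_push]
    refine Finset.sum_congr rfl fun x _ => ?_
    split_ifs with hx
    · rw [chr_hom, chr_hom, hW]
    · rfl
  exact_mod_cast h

/-- Maschke's argument: such an `s` exists fibrewise without equivariance, and the condition `f ∘ s
∘ f = f` is affine in `s` and stable under conjugation by `G`, so it survives averaging. -/
theorem exists_hom_comp_comp [Finite X] [Finite G] [CharZero K] {V W : Bundle K G X}
    (f : Hom V W) : ∃ s : Hom W V, ∀ x w, f.map x (s.map x (f.map x w)) = f.map x w := by
  have := Fintype.ofFinite G
  have hG : (Fintype.card G : K) ≠ 0 := by simp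
  have hs : ∀ x, ∃ s : W.fiber x →ₗ[K] V.fiber x, ∀ w, f.map x (s (f.map x w)) = f.map x w := by
    intro x
    obtain ⟨s, hs⟩ := (f.map x).rangeRestrict.exists_rightInverse_of_surjective
      (LinearMap.range_rangeRestrict _)
    obtain ⟨p, hp⟩ := Submodule.exists_isCompl (LinearMap.range (f.map x))
    -- A section of `f` over its range, extended by zero on a complement.
    refine ⟨s ∘ₗ Submodule.projectionOnto _ p hp, fun w => ?_⟩
    have h1 := Submodule.projectionOnto_apply_left hp ((f.map x).rangeRestrict w)
    have h2 := congrArg Subtype.val (LinearMap.congr_fun hs ((f.map x).rangeRestrict w))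
    simp only [LinearMap.comp_apply]
    erw [h1]
    exact h2
  choose s hs using hs
  let S : ((W.hom V).push (toPoint G X)).fiber PUnit.unit := fun x => s x.1
  obtain ⟨A, hA, hAS⟩ := (W.homRep V).exists_invariant_average S
  refine ⟨Hom.ofInvariant A hA, fun x w => ?_⟩
  have hcomp : ∀ w, comp x A w = (Fintype.card G : K)⁻¹ • ∑ g : G, comp x (W.homRep V g S) w := by
    intro w
    rw [hAS, map_smul, map_sum, LinearMap.smul_apply, LinearMap.sum_apply]
  change f.map x (comp x A _) = _
  rw [hcomp, map_smul, map_sum]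
  -- Each conjugate of `S` satisfies the same identity, so the sum consists of `|G|` copies of
  -- `f.map x w`.
  rw [Finset.sum_congr rfl (g := fun _ => f.map x w), Finset.sum_const, Finset.card_univ,
    ← Nat.cast_smul_eq_nsmul K, smul_smul, inv_mul_cancel₀ hG, one_smul]
  intro g _
  rw [comp_homRep S g (smul_inv_smul g x), f.comm, ← f.comm g⁻¹]
  change W.act g _ (f.map _ (s _ (f.map _ _))) = _
  rw [hs, f.comm, act_act_inv]


/-! ### Idempotents, and bundles with equal characters. -/

variable {K : Type u} [Field K] {G : Type v} [Group G] {X Y Z : Type v} [MulAction G X]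
  [MulAction G Y]

/-- The image of an endomorphism of a bundle. -/
def image {V : Bundle K G X} (e : Hom V V) : Bundle K G X where
  fiber x := LinearMap.range (e.map x)
  act g x y h := (V.act g h).restrict (p := LinearMap.range (e.map x))
    (q := LinearMap.range (e.map y)) (by rintro _ ⟨w, rfl⟩; exact ⟨V.act g h w, e.comm g h w⟩)
  act_one h w := Subtype.ext (V.act_one h w.1)
  act_mul g' g _ _ _ h h' h'' w := Subtype.ext (V.act_mul g' g h h' h'' w.1)

/-- The composition of two morphisms of bundles. -/
def Hom.comp {U V W : Bundle K G X} (f : Hom V W) (f' : Hom U V) : Hom U W where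
  map x := f.map x ∘ₗ f'.map x
  comm g x y h w := by simp [f.comm, f'.comm]

/-- The endomorphism `1 - e`. -/
def Hom.compl {V : Bundle K G X} (e : Hom V V) : Hom V V where
  map x := LinearMap.id - e.map x
  comm g x y h w := by simp [e.comm]

/-- The decomposition of a bundle attached to an idempotent endomorphism. -/
def isoImageAddImage {V : Bundle K G X} (e : Hom V V)
    (he : ∀ x w, e.map x (e.map x w) = e.map x w) : Iso V ((image e).add (image e.compl)) where
  equiv x :=
    { toFun := fun w => (⟨e.map x w, w, rfl⟩, ⟨w - e.map x w, w, rfl⟩)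
      map_add' := fun a b => Prod.ext (Subtype.ext (map_add _ a b)) (Subtype.ext (by
        change a + b - e.map x (a + b) = (a - e.map x a) + (b - e.map x b)
        rw [map_add]; abel))
      map_smul' := fun r a => Prod.ext (Subtype.ext (map_smul _ r a)) (Subtype.ext (by
        change r • a - e.map x (r • a) = r • (a - e.map x a)
        rw [map_smul, smul_sub]))
      invFun := fun p => p.1.1 + p.2.1
      left_inv := fun w => add_sub_cancel (e.map x w) w
      right_inv := by
        rintro ⟨⟨_, a, rfl⟩, ⟨_, b, rfl⟩⟩
        have h1 : e.map x (e.map x a + (b - e.map x b)) = e.map x a := by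
          rw [map_add, map_sub, he, he, sub_self, add_zero]
        refine Prod.ext (Subtype.ext h1) (Subtype.ext ?_)
        change (e.map x a + (b - e.map x b)) - e.map x (e.map x a + (b - e.map x b)) = b - e.map x b
        rw [h1, add_sub_cancel_left] }
  comm g x y h w := Prod.ext (Subtype.ext (e.comm g h w)) (Subtype.ext (by
    change V.act g h w - e.map y (V.act g h w) = V.act g h (w - e.map x w)
    rw [map_sub, e.comm]))

/-- If `f ∘ s ∘ f = f`, then the images of `s ∘ f` and
`f ∘ s` are isomorphic. -/
def isoImageComp {V W : Bundle K G X} (f : Hom V W) (s : Hom W V)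
    (h : ∀ x w, f.map x (s.map x (f.map x w)) = f.map x w) :
    Iso (image (s.comp f)) (image (f.comp s)) where
  equiv x :=
    { toFun := fun w => ⟨f.map x w.1, by
        obtain ⟨_, w, rfl⟩ := w
        exact ⟨f.map x w, rfl⟩⟩
      map_add' := fun a b => Subtype.ext (map_add _ _ _)
      map_smul' := fun r a => Subtype.ext (map_smul _ _ _)
      invFun := fun w => ⟨s.map x w.1, by
        obtain ⟨_, w, rfl⟩ := w
        exact ⟨s.map x w, rfl⟩⟩
      left_inv := by
        rintro ⟨_, w, rfl⟩
        exact Subtype.ext (congrArg (s.map x) (h x w))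
      right_inv := by
        rintro ⟨_, w, rfl⟩
        exact Subtype.ext (h x (s.map x w)) }
  comm g x y h w := Subtype.ext (f.comm g h w.1)

theorem chr_one_smul (V : Bundle K G X) (x : X) :
    V.chr (one_smul G x) = Module.finrank K (V.fiber x) := by
  have h : V.act 1 (one_smul G x) = LinearMap.id := LinearMap.ext fun w => V.act_one _ w
  rw [chr, h, LinearMap.trace_id]

/-- Two bundles with the same characters are isomorphic. -/
theorem nonempty_iso_of_chr_eq [Finite X] [Finite G] [CharZero K] (V W : Bundle K G X)
    (hVW : ∀ (g : G) (x : X) (h : g • x = x), V.chr h = W.chr h) : Nonempty (Iso V W) := by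
  have := Fintype.ofFinite X
  obtain ⟨n, hn⟩ : ∃ n, n = ∑ x, Module.finrank K (V.fiber x) := ⟨_, rfl⟩
  -- Induction on the total dimension: a nonzero morphism gives isomorphic nonzero summands of `V`
  -- and `W`, which are split off.
  induction n using Nat.strong_induction_on generalizing V W with
  | _ n ih =>
    by_cases h0 : ∀ x, Subsingleton (V.fiber x)
    · have hW : ∀ x, Subsingleton (W.fiber x) := fun x => by
        rw [← Module.finrank_eq_zero_iff_of_free (R := K)]
        have h := hVW 1 x (one_smul G x)
        rw [chr_one_smul, chr_one_smul, Module.finrank_zero_of_subsingleton] at h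
        exact_mod_cast h.symm
      exact ⟨⟨fun x => LinearEquiv.ofSubsingleton _ _, fun g x y h w => Subsingleton.elim _ _⟩⟩
    · push Not at h0
      obtain ⟨x, hx⟩ := h0
      -- The identity is a nonzero endomorphism of `V`; equality of characters then forces a nonzero
      -- morphism from `V` to `W`.
      have hid : Module.finrank K (V.homRep V).invariants ≠ 0 := by
        intro h
        rw [Module.finrank_eq_zero_iff_of_free] at h
        obtain ⟨w, hw⟩ := exists_ne (0 : V.fiber x)
        have h1 := Hom.mem_invariants (⟨fun x => LinearMap.id, fun _ _ _ _ _ => rfl⟩ : Hom V V)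
        have h2 := congrArg Subtype.val (h.elim ⟨_, h1⟩ 0)
        exact hw (LinearMap.congr_fun (congrFun h2 ⟨x, rfl⟩) w)
      rw [finrank_invariants_homRep_congr V V W hVW, ne_eq,
        Module.finrank_eq_zero_iff_of_free, not_subsingleton_iff_nontrivial] at hid
      obtain ⟨⟨φ, hφ⟩, hne⟩ := exists_ne (0 : (V.homRep W).invariants)
      let f := Hom.ofInvariant φ hφ
      obtain ⟨y, w, hw⟩ : ∃ y w, f.map y w ≠ 0 := by
        by_contra! hf
        refine hne (Subtype.ext (funext fun z => ?_))
        obtain ⟨z, _⟩ := z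
        exact LinearMap.ext fun w => hf z w
      obtain ⟨s, hs⟩ := exists_hom_comp_comp f
      -- Both `s ∘ f` and `f ∘ s` are idempotent with isomorphic images, so the complementary
      -- summands again have equal characters.
      have e1 := isoImageAddImage (s.comp f) fun x w => congrArg (s.map x) (hs x w)
      have e2 := isoImageAddImage (f.comp s) fun x w => hs x (s.map x w)
      have e3 := isoImageComp f s hs
      have hpos : 0 < Module.finrank K ((image (s.comp f)).fiber y) := by
        rw [Module.finrank_pos_iff]
        refine ⟨⟨⟨s.map y (f.map y w), w, rfl⟩, 0, fun h => hw ?_⟩⟩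
        rw [← hs, show s.map y (f.map y w) = 0 from congrArg Subtype.val h, map_zero]
      have hdim : ∀ z, Module.finrank K (V.fiber z) =
          Module.finrank K ((image (s.comp f)).fiber z) +
            Module.finrank K ((image (s.comp f).compl).fiber z) := fun z =>
        (e1.equiv z).finrank_eq.trans Module.finrank_prod
      obtain ⟨e4⟩ := ih (∑ z, Module.finrank K ((image (s.comp f).compl).fiber z)) (by
          rw [hn]
          refine Finset.sum_lt_sum (fun z _ => ?_) ⟨y, Finset.mem_univ y, ?_⟩
          · rw [hdim z]; exact Nat.le_add_left _ _
          · rw [hdim y]; omega)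
        (image (s.comp f).compl) (image (f.comp s).compl) (fun g z h => by
          have h1 := hVW g z h
          rw [e1.chr_eq, e2.chr_eq, chr_add, chr_add, e3.chr_eq] at h1
          exact add_left_cancel h1) rfl
      have e5 : Iso ((image (s.comp f)).add (image (s.comp f).compl))
          ((image (f.comp s)).add (image (f.comp s).compl)) :=
        ⟨fun x => (e3.equiv x).prodCongr (e4.equiv x), fun g _ _ h w =>
          Prod.ext (e3.comm g h w.1) (e4.comm g h w.2)⟩
      exact (isoSetoid K G X).trans ⟨e1⟩ ((isoSetoid K G X).trans ⟨e5⟩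
        ((isoSetoid K G X).symm ⟨e2⟩))

end Bundle

/-! ### Characters of virtual bundles. -/

section

variable {K : Type u} [Field K] {G : Type v} [Group G] {X Y Z : Type v} [MulAction G X]
  [MulAction G Y]

/-- The isomorphism class of a bundle. -/
def KPlus.mk (V : Bundle K G X) : KPlus K G X := Quotient.mk _ V

theorem KPlus.exists_mk (W : KPlus K G X) : ∃ V, W = KPlus.mk V :=
  let ⟨V, hV⟩ := Quotient.exists_rep W
  ⟨V, hV.symm⟩

/-- The character at `(g, x)`, for `x` fixed by `g`, of a class of bundles. -/
noncomputable def KPlus.chr {g : G} {x : X} (h : g • x = x) : KPlus K G X →+* K where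
  toFun := Quotient.lift (fun V => V.chr h) fun _ _ ⟨e⟩ => e.chr_eq h
  map_one' := Bundle.chr_one h
  map_zero' := Bundle.chr_zero h
  map_mul' := by rintro ⟨V⟩ ⟨W⟩; exact V.chr_mul W h
  map_add' := by rintro ⟨V⟩ ⟨W⟩; exact V.chr_add W h

/-- The character at `(g, x)`, for `x` fixed by `g`, of a virtual bundle. -/
noncomputable def chr {g : G} {x : X} (h : g • x = x) : KG K G X →+* K :=
  GrothendieckAddGroup.liftRing (KPlus.chr h)

theorem chr_cls {g : G} {x : X} (h : g • x = x) (W : KPlus K G X) :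
    chr h (cls W) = KPlus.chr h W :=
  GrothendieckAddGroup.liftRing_of _ _

theorem chr_cls_mk {g : G} {x : X} (h : g • x = x) (V : Bundle K G X) :
    chr h (cls (KPlus.mk V)) = V.chr h :=
  chr_cls h _

theorem exists_cls_sub_cls (z : KG K G X) : ∃ V W : KPlus K G X, z = cls V - cls W :=
  GrothendieckAddGroup.exists_of_sub_of z

/-- A virtual bundle is determined by its characters. -/
theorem ext_chr [Finite X] [Finite G] [CharZero K] {z t : KG K G X}
    (h : ∀ (g : G) (x : X) (hx : g • x = x), chr hx z = chr hx t) : z = t := by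
  rw [← sub_eq_zero]
  obtain ⟨V, W, hVW⟩ := exists_cls_sub_cls (z - t)
  rw [hVW, sub_eq_zero]
  obtain ⟨V, rfl⟩ := V.exists_mk
  obtain ⟨W, rfl⟩ := W.exists_mk
  refine congrArg cls (Quotient.sound (V.nonempty_iso_of_chr_eq W fun g x hx => ?_))
  have h1 := congrArg (chr hx) hVW
  rw [map_sub, h, sub_self, map_sub, chr_cls_mk, chr_cls_mk] at h1
  exact (sub_eq_zero.mp h1.symm)

theorem addHom_ext {A : Type*} [AddCommGroup A] {f f' : KG K G X →+ A}
    (h : ∀ W, f (cls W) = f' (cls W)) (z : KG K G X) : f z = f' z :=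
  DFunLike.congr_fun (GrothendieckAddGroup.hom_ext h) z

theorem chr_pull {S : Type v} [Group S] [MulAction S Z] (φ : S →* G) (f : Z →ₑ[φ] X)
    {s : S} {z : Z} (h : s • z = z) (t : KG K G X) :
    chr h (pull φ f t) = chr (show φ s • f z = f z by rw [← map_smulₛₗ, h]) t := by
  refine addHom_ext (f := (chr h).toAddMonoidHom.comp (pull φ f).toAddMonoidHom)
    (f' := (chr _).toAddMonoidHom) ?_ t
  intro W
  obtain ⟨W, rfl⟩ := W.exists_mk
  refine (congrArg (chr h) (GrothendieckAddGroup.mapAdd_of _ _)).trans ?_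
  exact (chr_cls_mk h (W.pull φ f)).trans (chr_cls_mk _ W).symm

theorem chr_res (f : X →[G] Y) {g : G} {x : X} (h : g • x = x) (t : KG K G Y) :
    chr h (res f t) = chr (show g • f x = f x by rw [← map_smul, h]) t :=
  chr_pull (MonoidHom.id G) f h t

open Classical in
theorem chr_push [Finite X] [Fintype X] (f : X →[G] Y) {g : G} {y : Y} (h : g • y = y)
    (z : KG K G X) :
    chr h (push f z) = ∑ x : X, if hx : f x = y ∧ g • x = x then chr hx.2 z else 0 := by
  refine (addHom_ext (f := (chr h).toAddMonoidHom.comp (push f))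
    (f' := ∑ x : X, if hx : f x = y ∧ g • x = x then (chr hx.2).toAddMonoidHom else 0) ?_ z).trans ?_
  · intro W
    obtain ⟨W, rfl⟩ := W.exists_mk
    refine (congrArg (chr h) (GrothendieckAddGroup.mapAdd_of _ _)).trans ?_
    refine (chr_cls_mk h (W.push f)).trans ((W.chr_push f h).trans ?_)
    rw [AddMonoidHom.finsetSum_apply]
    refine Finset.sum_congr rfl fun x _ => ?_
    split_ifs with hx
    · exact (chr_cls_mk _ W).symm
    · rfl
  · rw [AddMonoidHom.finsetSum_apply]
    refine Finset.sum_congr rfl fun x _ => ?_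
    split_ifs with hx <;> rfl

theorem chr_fiberAt (S : Subgroup G) (x : X) (h : S ≤ MulAction.stabilizer G x) {s : S}
    {o : PUnit.{v + 1}} (ho : s • o = o) (z : KG K G X) :
    chr ho (fiberAt S x h z) = chr (MulAction.mem_stabilizer_iff.mp (h s.2)) z :=
  chr_pull S.subtype _ ho z

end

end EquivariantK

/-! ### Set functions under convolution -/

/-- Functions on the subsets of `X`, as a ring under the convolution
`(a * b) C = ∑_{C = D ⊔ E} a D * b E`. -/
def SetFun (X R : Type*) : Type _ := Set X → R

namespace SetFun

variable {X R : Type*} [Finite X] [CommRing R]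

/-- The ordered partitions of `C` in two pieces. -/
noncomputable def splits (C : Set X) : Finset (Set X × Set X) :=
  (Set.toFinite {p : Set X × Set X | Disjoint p.1 p.2 ∧ p.1 ∪ p.2 = C}).toFinset

theorem mem_splits {C : Set X} {p : Set X × Set X} :
    p ∈ splits C ↔ Disjoint p.1 p.2 ∧ p.1 ∪ p.2 = C := by
  simp [splits]

instance : AddCommGroup (SetFun X R) := inferInstanceAs (AddCommGroup (Set X → R))

noncomputable instance : Mul (SetFun X R) where
  mul a b C := ∑ p ∈ splits C, a p.1 * b p.2

open Classical in
noncomputable instance : One (SetFun X R) where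
  one C := if C = ∅ then 1 else 0

theorem mul_apply (a b : SetFun X R) (C : Set X) :
    (a * b) C = ∑ p ∈ splits C, a p.1 * b p.2 := rfl

omit [Finite X] in
open Classical in
theorem one_apply (C : Set X) : (1 : SetFun X R) C = if C = ∅ then 1 else 0 := rfl

omit [Finite X] in
theorem add_apply (a b : SetFun X R) (C : Set X) : (a + b) C = a C + b C := rfl

omit [Finite X] in
theorem sub_apply (a b : SetFun X R) (C : Set X) : (a - b) C = a C - b C := rfl

protected theorem mul_comm (a b : SetFun X R) : a * b = b * a := by
  funext C
  refine Finset.sum_nbij' Prod.swap Prod.swap ?_ ?_ (fun _ _ => rfl) (fun _ _ => rfl)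
    fun p _ => mul_comm _ _
  all_goals
    intro p hp
    rw [mem_splits] at hp ⊢
    exact ⟨hp.1.symm, (Set.union_comm _ _).trans hp.2⟩

protected theorem one_mul (a : SetFun X R) : 1 * a = a := by
  funext C
  rw [mul_apply, Finset.sum_eq_single (∅, C)]
  · rw [one_apply, if_pos rfl, one_mul]
  · rintro ⟨D, E⟩ hp hne
    rw [one_apply, if_neg, zero_mul]
    rintro rfl
    rw [mem_splits] at hp
    exact hne (Prod.ext rfl (by simpa using hp.2))
  · intro h
    exact absurd (mem_splits.mpr ⟨Set.empty_disjoint _, Set.empty_union _⟩) h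

/-- Both sides are sums over the ordered partitions of `C` in three pieces. -/
protected theorem mul_assoc (a b c : SetFun X R) : a * b * c = a * (b * c) := by
  funext C
  simp only [mul_apply, Finset.sum_mul, Finset.mul_sum]
  rw [Finset.sum_sigma', Finset.sum_sigma']
  refine Finset.sum_nbij' (fun x => ⟨(x.2.1, x.2.2 ∪ x.1.2), (x.2.2, x.1.2)⟩)
    (fun x => ⟨(x.1.1 ∪ x.2.1, x.2.2), (x.1.1, x.2.1)⟩) ?_ ?_ ?_ ?_ fun x _ => mul_assoc _ _ _
  · rintro ⟨⟨D, E⟩, ⟨D', E'⟩⟩ h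
    simp only [Finset.mem_sigma, mem_splits] at h ⊢
    obtain ⟨⟨h1, rfl⟩, h2, rfl⟩ := h
    rw [Set.disjoint_union_left] at h1
    exact ⟨⟨Set.disjoint_union_right.mpr ⟨h2, h1.1⟩, (Set.union_assoc _ _ _).symm⟩, h1.2, trivial⟩
  · rintro ⟨⟨D, E⟩, ⟨D', E'⟩⟩ h
    simp only [Finset.mem_sigma, mem_splits] at h ⊢
    obtain ⟨⟨h1, rfl⟩, h2, rfl⟩ := h
    rw [Set.disjoint_union_right] at h1
    exact ⟨⟨Set.disjoint_union_left.mpr ⟨h1.2, h2⟩, Set.union_assoc _ _ _⟩, h1.1, trivial⟩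
  · rintro ⟨⟨D, E⟩, ⟨D', E'⟩⟩ h
    simp only [Finset.mem_sigma, mem_splits] at h ⊢
    obtain ⟨-, -, rfl⟩ := h
    rfl
  · rintro ⟨⟨D, E⟩, ⟨D', E'⟩⟩ h
    simp only [Finset.mem_sigma, mem_splits] at h ⊢
    obtain ⟨-, -, rfl⟩ := h
    rfl

protected theorem mul_add (a b c : SetFun X R) : a * (b + c) = a * b + a * c := by
  funext C
  simp only [mul_apply, add_apply, mul_add, Finset.sum_add_distrib]

noncomputable instance : CommRing (SetFun X R) where
  __ := (inferInstance : AddCommGroup (SetFun X R))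
  mul_assoc := SetFun.mul_assoc
  one_mul := SetFun.one_mul
  mul_one a := (SetFun.mul_comm a 1).trans a.one_mul
  mul_comm := SetFun.mul_comm
  left_distrib := SetFun.mul_add
  right_distrib a b c := by
    rw [SetFun.mul_comm, SetFun.mul_add, SetFun.mul_comm c a, SetFun.mul_comm c b]
  zero_mul a := funext fun C => Finset.sum_eq_zero fun _ _ => zero_mul _
  mul_zero a := funext fun C => Finset.sum_eq_zero fun _ _ => mul_zero _

theorem mul_empty (a b : SetFun X R) : (a * b) ∅ = a ∅ * b ∅ := by
  rw [mul_apply, Finset.sum_eq_single (∅, ∅)]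
  · rintro ⟨D, E⟩ hp hne
    rw [mem_splits] at hp
    have h := Set.union_empty_iff.mp hp.2
    exact absurd (Prod.ext h.1 h.2) hne
  · intro h
    exact absurd (mem_splits.mpr ⟨Set.empty_disjoint _, Set.empty_union _⟩) h

/-- By induction `a ^ n` vanishes on sets with fewer than `n` elements: a nonempty second piece
leaves a strictly smaller first piece. -/
theorem pow_card_succ_eq_zero {a : SetFun X R} (ha : a ∅ = 0) : a ^ (Nat.card X + 1) = 0 := by
  have h : ∀ (n : ℕ) (C : Set X), C.ncard < n → (a ^ n) C = 0 := by
    intro n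
    induction n with
    | zero => intro C hC; omega
    | succ n ih =>
      intro C hC
      rw [pow_succ, mul_apply]
      refine Finset.sum_eq_zero fun p hp => ?_
      rw [mem_splits] at hp
      rcases p.2.eq_empty_or_nonempty with h2 | h2
      · rw [h2, ha, mul_zero]
      · rw [ih, zero_mul]
        have h3 := Set.ncard_union_eq hp.1
        rw [hp.2] at h3
        have h4 := h2.ncard_pos
        omega
  exact funext fun C => h _ C (Nat.lt_succ_of_le (Set.ncard_le_card C))

/-- The set function `C ↦ ∏_{c ∈ C} x c`. -/
noncomputable def ofProd (x : X → R) : SetFun X R := fun C => ∏ᶠ c ∈ C, x c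

/-- Expanding `∏ (x c + y c)`, the points where `x` is chosen form the first piece of a splitting of
`C`. -/
theorem ofProd_add (x y : X → R) : ofProd (x + y) = ofProd x * ofProd y := by
  classical
  funext C
  rw [mul_apply]
  simp only [ofProd]
  simp only [finprod_mem_eq_finite_toFinset_prod _ (Set.toFinite _), Pi.add_apply]
  rw [Finset.prod_add]
  refine Finset.sum_bij' (fun t _ => ((t : Set X), C \ t)) (fun p _ => (Set.toFinite p.1).toFinset)
    ?_ ?_ ?_ ?_ ?_
  · intro t ht
    rw [Finset.mem_powerset, Set.Finite.subset_toFinset] at ht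
    exact mem_splits.mpr ⟨Set.disjoint_sdiff_right, Set.union_sdiff_cancel ht⟩
  · intro p hp
    rw [mem_splits] at hp
    rw [Finset.mem_powerset, Set.Finite.toFinset_subset_toFinset, ← hp.2]
    exact Set.subset_union_left
  · intro t ht
    simp
  · rintro ⟨D, E⟩ hp
    rw [mem_splits] at hp
    obtain ⟨h, rfl⟩ := hp
    simp [Set.union_sdiff_cancel_left (Set.disjoint_iff.mp h)]
  · intro t ht
    congr 2
    · simp
    · ext; simp

end SetFun

/-! ### Cyclic sums -/

section CyclicSum

variable {X K : Type*} [Fintype X] [CommRing K] (σ : X → X)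

open Classical in
/-- The sum over all families `s` of indices over `C` of the products of the matrix coefficients
at `(s x, s (σ x))`. -/
noncomputable def cyclicSum {J : X → Type*} [∀ x, Fintype (J x)] (M : ∀ x, J x → J (σ x) → K)
    (C : Set X) : K :=
  ∑ s : (∀ x : C, J x), ∏ x : C, if h : σ x ∈ C then M x (s x) (s ⟨σ x, h⟩) else 0

variable {P Q : X → Type*} [∀ x, Fintype (P x)] [∀ x, Fintype (Q x)]

/-- The block diagonal family of matrices attached to two families of matrices. -/
def blockDiagonal (M : ∀ x, P x → P (σ x) → K) (N : ∀ x, Q x → Q (σ x) → K) (x : X) :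
    P x ⊕ Q x → P (σ x) ⊕ Q (σ x) → K
  | .inl i, .inl j => M x i j
  | .inr i, .inr j => N x i j
  | _, _ => 0

open Classical in
/-- The family with components `p` on `D` and `q` outside of `D`. -/
noncomputable def glue {C : Set X} (t : Σ D : {D : Set X // D ⊆ C},
    (∀ x : D.1, P x) × (∀ x : (C \ D.1 : Set X), Q x)) (x : C) : P x ⊕ Q x :=
  if h : x.1 ∈ t.1.1 then .inl (t.2.1 ⟨x, h⟩) else .inr (t.2.2 ⟨x, x.2, h⟩)

-- A family with values in `P ⊕ Q` is recovered from the set `D` where it takes values on the left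
-- and its components on `D` and `C \ D`.
omit [Fintype X] [∀ x, Fintype (P x)] [∀ x, Fintype (Q x)] in
theorem bijective_glue (C : Set X) : Function.Bijective (glue (P := P) (Q := Q) (C := C)) := by
  constructor
  · rintro ⟨⟨D, hD⟩, p, q⟩ ⟨⟨D', hD'⟩, p', q'⟩ h
    have hx : ∀ x : C, (x.1 ∈ D ↔ x.1 ∈ D') := fun x => by
      have := congrFun h x
      simp only [glue] at this
      by_cases h1 : x.1 ∈ D <;> by_cases h2 : x.1 ∈ D' <;> simp [h1, h2] at this ⊢
    obtain rfl : D = D' := by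
      ext x
      exact ⟨fun h => (hx ⟨x, hD h⟩).mp h, fun h => (hx ⟨x, hD' h⟩).mpr h⟩
    have hp : p = p' := funext fun x => by
      have := congrFun h ⟨x, hD x.2⟩
      simpa [glue] using this
    have hq : q = q' := funext fun x => by
      have := congrFun h ⟨x, x.2.1⟩
      simpa [glue, x.2.2] using this
    rw [hp, hq]
  · intro s
    refine ⟨⟨⟨{x | ∃ h : x ∈ C, (s ⟨x, h⟩).isLeft}, fun x hx => hx.1⟩,
      fun x => (s ⟨x, x.2.1⟩).getLeft x.2.2,
      fun x => (s ⟨x, x.2.1⟩).getRight (by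
        have h := x.2.2
        simp only [Set.mem_ofPred_eq, not_exists] at h
        simpa using h x.2.1)⟩, ?_⟩
    funext x
    by_cases h : (s x).isLeft
    · simp [glue, h]
    · have h' : ¬ ∃ h : x.1 ∈ C, (s ⟨x, h⟩).isLeft := fun h1 => h h1.2
      simp only [glue, Set.mem_ofPred_eq, h', dite_false, Sum.inr_getRight]

open Classical in
theorem prod_subset_mul_prod_diff {C D E : Set X} (hD : D ⊆ C) (hE : E = C \ D) (F : C → K) :
    ∏ x, F x = (∏ x : D, F ⟨x, hD x.2⟩) * ∏ x : E, F ⟨x, (hE ▸ x.2 : x.1 ∈ C \ D).1⟩ := by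
  subst hE
  rw [← Equiv.prod_comp (Equiv.Set.sumDiffSubset hD), Fintype.prod_sum_type]
  congr 1
  exact Finset.prod_congr (congrArg (@Finset.univ _) (Subsingleton.elim _ _)) fun x _ => rfl

/-- The families of indices are sorted by the set `D` where they take values on the left. A block
diagonal coefficient vanishes when the side changes between `x` and `σ x`; this matches the zero
that `cyclicSum` assigns when `σ` leaves `D` or `C \ D`. This is the source of the multiplicativity
of `χ`. -/
theorem cyclicSum_blockDiagonal (M : ∀ x, P x → P (σ x) → K) (N : ∀ x, Q x → Q (σ x) → K)
    (C : Set X) : cyclicSum σ (blockDiagonal σ M N) C =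
      ∑ p ∈ SetFun.splits C, cyclicSum σ M p.1 * cyclicSum σ N p.2 := by
  classical
  have e : ∑ p ∈ SetFun.splits C, cyclicSum σ M p.1 * cyclicSum σ N p.2 =
      ∑ D : {D : Set X // D ⊆ C}, cyclicSum σ M D.1 * cyclicSum σ N (C \ D.1) := by
    refine Finset.sum_bij' (fun p hp => ⟨p.1, by
        rw [← (SetFun.mem_splits.mp hp).2]; exact Set.subset_union_left⟩)
      (fun D _ => (D.1, C \ D.1)) (fun _ _ => Finset.mem_univ _)
      (fun D _ => SetFun.mem_splits.mpr ⟨Set.disjoint_sdiff_right, Set.union_sdiff_cancel D.2⟩)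
      ?_ (fun _ _ => rfl) ?_
    all_goals
      rintro ⟨D, E⟩ hp
      obtain ⟨h, rfl⟩ := SetFun.mem_splits.mp hp
      simp only at h
      simp [Set.union_sdiff_cancel_left (Set.disjoint_iff.mp h)]
  rw [e, cyclicSum]
  rw [← Function.Bijective.sum_comp (bijective_glue C), Fintype.sum_sigma]
  refine Fintype.sum_congr _ _ fun D => ?_
  rw [Fintype.sum_prod_type, cyclicSum, cyclicSum, Finset.sum_mul_sum]
  convert (rfl : _ = _) using 4
  rename_i p _ q _
  symm
  rw [prod_subset_mul_prod_diff (K := K) D.2 rfl]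
  congr 1
  · refine Fintype.prod_congr _ _ fun x => ?_
    by_cases h : σ x ∈ D.1
    · simp [glue, blockDiagonal, h, D.2 h]
    · by_cases h' : σ x ∈ C <;> simp [glue, blockDiagonal, h, h']
  · refine Finset.prod_congr rfl fun x _ => ?_
    by_cases h' : σ x ∈ C
    · by_cases h : σ x ∈ D.1 <;> simp [glue, blockDiagonal, h, h', x.2.2]
    · have h1 : σ x ∉ C \ D.1 := fun h2 => h' h2.1
      simp [h']

end CyclicSum

/-! ### Characters of norms in terms of matrix coefficients. -/

namespace EquivariantK

namespace Bundle

variable {K : Type u} [Field K] {G : Type v} [Group G] {X Y Z : Type v} [MulAction G X]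
  [MulAction G Y] [MulAction G Z]

/-- In the tensor product basis, `g` moves the factor at `z` to `g • z`, so a diagonal coefficient
is a product of coefficients linking the index at `z` to the one at `g • z`. -/
theorem chr_norm [Finite Z] (V : Bundle K G Z) (f : Z →[G] Y) {g : G} {y : Y} (h : g • y = y)
    [Fintype {z // f z = y}] [DecidableEq {z // f z = y}] {κ : Z → Type*} [∀ z, Fintype (κ z)]
    (b : ∀ z, Module.Basis (κ z) K (V.fiber z)) :
    (V.norm f).chr h = ∑ s : (∀ z : {z // f z = y}, κ z.1),
      ∏ z, (b (g • z.1)).repr (V.act g rfl (b z.1 (s z))) (s (fiberEquiv f g h z)) := by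
  classical
  refine (LinearMap.trace_eq_matrix_trace K
    (Basis.piTensorProduct fun z : {z // f z = y} => b z.1) _).trans ?_
  refine Finset.sum_congr rfl fun s _ => ?_
  refine (LinearMap.toMatrix_apply _ _ _ _ _).trans ?_
  refine (congrArg (fun t => (Basis.piTensorProduct fun z : {z // f z = y} => b z.1).repr t s)
    ((congrArg ((V.norm f).act g h) (Basis.piTensorProduct_apply _ s)).trans
      (V.norm_act_tprod f g h _))).trans ?_
  rw [Basis.piTensorProduct_repr_tprod_apply, ← Equiv.prod_comp (fiberEquiv f g h)]
  refine Fintype.prod_congr _ _ fun z => ?_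
  have key : ∀ z' : {z // f z = y}, z' = z → ∀ h' : g • z'.1 = g • z.1,
      (b (g • z.1)).repr (V.act g h' (b z'.1 (s z'))) (s (fiberEquiv f g h z)) =
        (b (g • z.1)).repr (V.act g rfl (b z.1 (s z))) (s (fiberEquiv f g h z)) := by
    rintro _ rfl h'
    rfl
  exact key _ (Equiv.symm_apply_apply _ z) _

/-- The matrix coefficients of `g` in bases of the fibres. -/
noncomputable def coeff (W : Bundle K G X) {κ : X → Type*}
    (b : ∀ x, Module.Basis (κ x) K (W.fiber x)) (g : G) (x : X) (i : κ x) (j : κ (g • x)) : K :=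
  (b (g • x)).repr (W.act g rfl (b x i)) j

/-- The generality covers `χ(W)`, a norm from the pairs `(x, C)`, together with `f_♯`, where `π` is
the identity: all that matters is that the fibre of `f` corresponds to `C`. -/
theorem chr_norm_pull [Finite Z] [Fintype X] (W : Bundle K G X) (π : Z →[G] X) (f : Z →[G] Y)
    {g : G} {y : Y} (h : g • y = y) {C : Set X} (hC : Set.BijOn π {z | f z = y} C)
    {κ : X → Type*} [∀ x, Fintype (κ x)] (b : ∀ x, Module.Basis (κ x) K (W.fiber x)) :
    ((W.pull (MonoidHom.id G) π).norm f).chr h = cyclicSum (g • ·) (W.coeff b g) C := by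
  classical
  have := Fintype.ofFinite {z // f z = y}
  let e : {z // f z = y} → C := fun z => ⟨π z.1, hC.mapsTo z.2⟩
  have he : Function.Bijective e := by
    constructor
    · intro z z' hz
      exact Subtype.ext (hC.injOn z.2 z'.2 (congrArg Subtype.val hz))
    · rintro ⟨x, hx⟩
      obtain ⟨z, hz, rfl⟩ := hC.surjOn hx
      exact ⟨⟨z, hz⟩, rfl⟩
  rw [chr_norm (W.pull (MonoidHom.id G) π) f h (fun z => b (π z)), cyclicSum]
  symm
  refine Fintype.sum_equiv
    (Equiv.piCongrLeft (fun x : C => κ x.1) (Equiv.ofBijective e he)).symm _ _ fun s => ?_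
  refine Fintype.prod_equiv (Equiv.ofBijective e he).symm _ _ fun x => ?_
  obtain ⟨z, rfl⟩ := he.2 x
  rw [Equiv.ofBijective_symm_apply_apply]
  have hz : g • (e z).1 = (e (fiberEquiv f g h z)).1 := (map_smul π g z.1).symm
  have key : ∀ (y : X) (hy : g • (e z).1 = y) (m : y ∈ C),
      (if h' : g • (e z).1 ∈ C then W.coeff b g (e z).1 (s (e z)) (s ⟨g • (e z).1, h'⟩) else 0) =
        (b y).repr (W.act g hy (b (e z).1 (s (e z)))) (s ⟨y, m⟩) := by
    rintro _ rfl m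
    rw [dif_pos m]
    rfl
  exact key _ hz _

theorem coeff_add (V W : Bundle K G X) {κ κ' : X → Type*}
    (b : ∀ x, Module.Basis (κ x) K (V.fiber x)) (b' : ∀ x, Module.Basis (κ' x) K (W.fiber x))
    (g : G) : (V.add W).coeff (fun x => (b x).prod (b' x)) g =
      fun x => blockDiagonal (g • ·) (V.coeff b g) (W.coeff b' g) x := by
  funext x i j
  change ((b (g • x)).prod (b' (g • x))).repr
    ((V.act g rfl).prodMap (W.act g rfl) ((b x).prod (b' x) i)) j = _
  rcases i with i | i <;> rcases j with j | j <;> simp [blockDiagonal, coeff]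

end Bundle

/-! ### Characters over the set of subsets, as functions under convolution. -/

section

variable {K : Type u} [Field K] {G : Type v} [Group G] [Finite G] (H : Subgroup G)

open Classical in
/-- The character of a virtual bundle over the set of subsets of `G ⧸ H`, as a family of set
functions supported on invariant subsets. -/
noncomputable def setChr : KG K G (Set (G ⧸ H)) →+ G → SetFun (G ⧸ H) K where
  toFun z g C := if h : g • C = C then chr h z else 0
  map_zero' := by
    funext g C
    change (if h : g • C = C then chr h (0 : KG K G (Set (G ⧸ H))) else 0) = 0
    simp
  map_add' z t := by
    funext g C
    change _ = (if h : g • C = C then chr h z else 0) + (if h : g • C = C then chr h t else 0)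
    split_ifs with h
    · exact map_add _ _ _
    · exact (add_zero 0).symm

variable {H}

theorem setChr_of_smul_eq {g : G} {C : Set (G ⧸ H)} (h : g • C = C) (z : KG K G (Set (G ⧸ H))) :
    setChr H z g C = chr h z :=
  dif_pos h

theorem setChr_of_smul_ne {g : G} {C : Set (G ⧸ H)} (h : g • C ≠ C) (z : KG K G (Set (G ⧸ H))) :
    setChr H z g C = 0 :=
  dif_neg h

theorem setChr_injective [CharZero K] : Function.Injective (setChr (K := K) H) := by
  intro z t h
  refine ext_chr fun g C hC => ?_
  rw [← setChr_of_smul_eq hC, h, setChr_of_smul_eq hC]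

/-- A pair of disjoint subsets is fixed by `g` exactly when both members are, and extension by zero
discards the other splittings, so the trace on the pushforward is the full convolution sum. -/
theorem setChr_vee (z t : KG K G (Set (G ⧸ H))) :
    setChr H (vee H z t) = setChr H z * setChr H t := by
  classical
  have := Fintype.ofFinite (DisjPairs H)
  funext g C
  rw [Pi.mul_apply, SetFun.mul_apply]
  have hterm : ∑ p ∈ SetFun.splits C, setChr H z g p.1 * setChr H t g p.2 =
      ∑ q : DisjPairs H, if DisjPairs.union H q = C
        then setChr H z g q.1.1 * setChr H t g q.1.2 else 0 := by
    rw [← Finset.sum_filter]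
    symm
    refine Finset.sum_bij (fun q _ => q.1) ?_ ?_ ?_ fun _ _ => rfl
    · intro q hq
      exact SetFun.mem_splits.mpr ⟨q.2, (Finset.mem_filter.mp hq).2⟩
    · intro q _ q' _ h
      exact Subtype.ext h
    · intro p hp
      obtain ⟨h1, h2⟩ := SetFun.mem_splits.mp hp
      exact ⟨⟨p, h1⟩, Finset.mem_filter.mpr ⟨Finset.mem_univ _, h2⟩, rfl⟩
  rw [hterm]
  by_cases hC : g • C = C
  · rw [setChr_of_smul_eq hC, vee, chr_push]
    refine Fintype.sum_congr _ _ fun q => ?_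
    by_cases hq : DisjPairs.union H q = C
    · rw [if_pos hq]
      by_cases h1 : g • q = q
      · have h2 : g • q.1 = q.1 := congrArg Subtype.val h1
        have h3 : g • q.1.1 = q.1.1 := congrArg Prod.fst h2
        have h4 : g • q.1.2 = q.1.2 := congrArg Prod.snd h2
        rw [dif_pos ⟨hq, h1⟩, map_mul, chr_res, chr_res, setChr_of_smul_eq h3,
          setChr_of_smul_eq h4]
        rfl
      · rw [dif_neg fun h => h1 h.2]
        by_cases h3 : g • q.1.1 = q.1.1
        · by_cases h4 : g • q.1.2 = q.1.2
          · exact absurd (Subtype.ext (Prod.ext h3 h4)) h1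
          · rw [setChr_of_smul_ne h4, mul_zero]
        · rw [setChr_of_smul_ne h3, zero_mul]
    · rw [if_neg hq, dif_neg fun h => hq h.1]
  -- If `C` is not invariant, no splitting of it has both pieces invariant.
  · rw [setChr_of_smul_ne hC]
    symm
    refine Finset.sum_eq_zero fun q _ => ?_
    split_ifs with hq
    · by_cases h3 : g • q.1.1 = q.1.1
      · by_cases h4 : g • q.1.2 = q.1.2
        · refine absurd ?_ hC
          rw [← hq]
          change g • (q.1.1 ∪ q.1.2) = q.1.1 ∪ q.1.2
          rw [Set.smul_set_union, h3, h4]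
        · rw [setChr_of_smul_ne h4, mul_zero]
      · rw [setChr_of_smul_ne h3, zero_mul]
    · rfl

theorem setChr_veeOne : setChr (K := K) H (veeOne H) = 1 := by
  classical
  funext g C
  rw [Pi.one_apply, SetFun.one_apply]
  by_cases hC : g • C = C
  · rw [setChr_of_smul_eq hC, veeOne, chr_push, Fintype.sum_unique]
    by_cases h : C = ∅
    · rw [if_pos h, dif_pos ⟨h.symm, rfl⟩, map_one]
    · rw [if_neg h, dif_neg fun h' => h h'.1.symm]
  · rw [setChr_of_smul_ne hC, if_neg]
    rintro rfl
    exact hC Set.smul_set_empty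

/-- As `C` is finite, some point of it is moved out of `C`, and its factor kills every term. -/
theorem cyclicSum_eq_zero {g : G} {C : Set (G ⧸ H)} [Fintype (G ⧸ H)] (hC : g • C ≠ C)
    {κ : G ⧸ H → Type*} [∀ x, Fintype (κ x)] (M : ∀ x, κ x → κ (g • x) → K) :
    cyclicSum (g • ·) M C = 0 := by
  classical
  obtain ⟨x, hx, hgx⟩ : ∃ x ∈ C, g • x ∉ C := by
    by_contra! h
    refine hC (Set.eq_of_subset_of_ncard_le ?_ (Set.ncard_smul_set g C).ge (Set.toFinite C))
    rintro _ ⟨x, hx, rfl⟩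
    exact h x hx
  refine Finset.sum_eq_zero fun s _ => ?_
  exact Finset.prod_eq_zero (Finset.mem_univ ⟨x, hx⟩) (dif_neg hgx)

theorem setChr_chiPlus [Fintype (G ⧸ H)] (W : Bundle K G (G ⧸ H)) {κ : G ⧸ H → Type*}
    [∀ x, Fintype (κ x)] (b : ∀ x, Module.Basis (κ x) K (W.fiber x)) (g : G) :
    setChr H (cls (chiPlus H (KPlus.mk W))) g = cyclicSum (g • ·) (W.coeff b g) := by
  funext C
  by_cases hC : g • C = C
  · rw [setChr_of_smul_eq hC]
    refine (chr_cls_mk hC _).trans (W.chr_norm_pull (Pointed.point H) (Pointed.set H) hC ?_ b)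
    refine ⟨?_, ?_, ?_⟩
    · rintro ⟨⟨x, D⟩, hx⟩ rfl
      exact hx
    · rintro ⟨⟨x, D⟩, hx⟩ rfl ⟨⟨x', D'⟩, hx'⟩ h1 h2
      exact Subtype.ext (Prod.ext h2 h1.symm)
    · intro x hx
      exact ⟨⟨(x, C), hx⟩, rfl, rfl⟩
  · rw [setChr_of_smul_ne hC, cyclicSum_eq_zero hC]

/-- Both sides are the same cyclic sum over all of `G ⧸ H`. On actual bundles this identifies the
fibre of `χ` at the full set with tensor induction. -/
theorem chr_normPlus (W : KPlus K G (G ⧸ H)) (g : G) (o : PUnit.{v + 1}) (ho : g • o = o) :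
    chr ho (cls (normPlus H W)) = setChr H (cls (chiPlus H W)) g Set.univ := by
  have := Fintype.ofFinite (G ⧸ H)
  obtain ⟨W, rfl⟩ := W.exists_mk
  have b := fun x => Module.finBasis K (W.fiber x)
  rw [setChr_chiPlus W b]
  refine (chr_cls_mk ho _).trans
    (W.chr_norm_pull (MulActionHom.id G) (toPoint G (G ⧸ H)) ho ⟨?_, ?_, ?_⟩ b)
  · intro x _
    trivial
  · intro x _ y _ h
    exact h
  · intro x _
    exact ⟨x, rfl, rfl⟩

/-- In bases adapted to the direct sum the matrices of `g` are block diagonal, and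
`cyclicSum_blockDiagonal` applies. -/
theorem setChr_chiPlus_add (V W : KPlus K G (G ⧸ H)) :
    setChr H (cls (chiPlus H (V + W))) =
      setChr H (cls (chiPlus H V)) * setChr H (cls (chiPlus H W)) := by
  have := Fintype.ofFinite (G ⧸ H)
  obtain ⟨V, rfl⟩ := V.exists_mk
  obtain ⟨W, rfl⟩ := W.exists_mk
  let b := fun x => Module.finBasis K (V.fiber x)
  let b' := fun x => Module.finBasis K (W.fiber x)
  funext g C
  rw [Pi.mul_apply, SetFun.mul_apply, setChr_chiPlus V b, setChr_chiPlus W b']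
  refine (congrFun (setChr_chiPlus (V.add W) (fun x => (b x).prod (b' x)) g) C).trans ?_
  rw [Bundle.coeff_add]
  exact cyclicSum_blockDiagonal _ _ _ C

theorem setChr_chiPlus_empty (W : KPlus K G (G ⧸ H)) (g : G) :
    setChr H (cls (chiPlus H W)) g ∅ = 1 := by
  have := Fintype.ofFinite (G ⧸ H)
  obtain ⟨W, rfl⟩ := W.exists_mk
  rw [setChr_chiPlus W fun x => Module.finBasis K (W.fiber x)]
  simp [cyclicSum]

/-- Over an element acting trivially, the character of `χ(W)` is a product. -/
theorem setChr_chiPlus_of_trivial (W : KPlus K G (G ⧸ H)) {g : G}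
    (hg : ∀ c : G ⧸ H, g • c = c) :
    setChr H (cls (chiPlus H W)) g = SetFun.ofProd fun c => chr (hg c) (cls W) := by
  classical
  have := Fintype.ofFinite (G ⧸ H)
  obtain ⟨W, rfl⟩ := W.exists_mk
  let b := fun x => Module.finBasis K (W.fiber x)
  have h1 : ∀ c, chr (hg c) (cls (KPlus.mk W)) =
      ∑ j, (b c).repr (W.act g (hg c) (b c j)) j := by
    intro c
    refine (chr_cls_mk (hg c) W).trans ((LinearMap.trace_eq_matrix_trace K (b c) _).trans ?_)
    exact Finset.sum_congr rfl fun j _ => LinearMap.toMatrix_apply _ _ _ _ _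
  rw [setChr_chiPlus W b]
  funext C
  rw [SetFun.ofProd, finprod_mem_eq_finite_toFinset_prod _ (Set.toFinite C),
    Finset.prod_subtype (F := Subtype.fintype _) (p := fun x => x ∈ C) _ (by simp)]
  simp only [h1]
  rw [Finset.prod_univ_sum, cyclicSum]
  refine Finset.sum_congr (by ext; simp) fun s _ => Fintype.prod_congr _ _ fun x => ?_
  have key : ∀ (y : G ⧸ H) (hy : g • x.1 = y) (m : y ∈ C),
      (if h' : g • x.1 ∈ C then W.coeff b g x.1 (s x) (s ⟨g • x.1, h'⟩) else 0) =
        (b y).repr (W.act g hy (b x.1 (s x))) (s ⟨y, m⟩) := by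
    rintro _ rfl m
    rw [dif_pos m]
    rfl
  exact key _ (hg x) x.2

end

end EquivariantK

namespace SetFun

variable {X R : Type*} [Finite X] [CommRing R]

/-- Only the splittings with first piece empty or full survive; they are distinct because `X` is
nonempty. -/
theorem mul_univ [Nonempty X] {a : SetFun X R} (ha : ∀ D, D ≠ ∅ → D ≠ Set.univ → a D = 0)
    (b : SetFun X R) : (a * b) Set.univ = a ∅ * b Set.univ + a Set.univ * b ∅ := by
  rw [mul_apply, Finset.sum_eq_add (∅, Set.univ) (Set.univ, ∅)]
  · intro h
    exact Set.empty_ne_univ (congrArg Prod.fst h)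
  · rintro ⟨D, E⟩ hp ⟨h1, h2⟩
    obtain ⟨hd, hu⟩ := mem_splits.mp hp
    simp only at hd hu
    rw [ha, zero_mul]
    · rintro rfl
      exact h1 (Prod.ext rfl (by simpa using hu))
    · rintro rfl
      exact h2 (Prod.ext rfl (Set.univ_disjoint.mp hd))
  · intro h
    exact absurd (mem_splits.mpr ⟨Set.empty_disjoint _, Set.empty_union _⟩) h
  · intro h
    exact absurd (mem_splits.mpr ⟨Set.disjoint_empty _, Set.union_empty _⟩) h

end SetFun

/-! ### Existence and uniqueness of `χ` on virtual bundles. -/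

namespace EquivariantK

section

variable {K : Type u} [Field K] {G : Type v} [Group G] [Finite G] {H : Subgroup G}

variable (K H) in
/-- The ring of characters of virtual bundles over the set of subsets of `G ⧸ H`. -/
noncomputable def setChrRange : Subring (G → SetFun (G ⧸ H) K) where
  __ := (setChr (K := K) H).range
  one_mem' := ⟨veeOne H, setChr_veeOne⟩
  mul_mem' := by
    rintro _ _ ⟨z, rfl⟩ ⟨t, rfl⟩
    exact ⟨vee H z t, setChr_vee z t⟩

/-- The difference `1 - χ(W)` vanishes at `∅`, hence is nilpotent with an exponent independent of
`g`. Working inside the subring ensures that the inverse is again the character of a virtual bundle.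
-/
theorem isUnit_setChr_chiPlus (W : KPlus K G (G ⧸ H)) :
    IsUnit (⟨setChr H (cls (chiPlus H W)), _, rfl⟩ : setChrRange K H) := by
  rw [← sub_sub_cancel 1 (⟨setChr H (cls (chiPlus H W)), _, rfl⟩ : setChrRange K H)]
  refine IsNilpotent.isUnit_one_sub ?_
  refine ⟨Nat.card (G ⧸ H) + 1, Subtype.ext (funext fun g => ?_)⟩
  refine SetFun.pow_card_succ_eq_zero (a := 1 - setChr H (cls (chiPlus H W)) g) ?_
  rw [SetFun.sub_apply, setChr_chiPlus_empty, SetFun.one_apply, if_pos rfl, sub_self]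

/-- On actual bundles `χ` is a homomorphism from direct sums to units of `setChrRange`, so it
extends to the Grothendieck group; injectivity of `setChr` carries the identities back to virtual
bundles. -/
theorem exists_isChiExtension [CharZero K] :
    ∃ c : KG K G (G ⧸ H) → KG K G (Set (G ⧸ H)), IsChiExtension H c := by
  let u : KG K G (G ⧸ H) →+ Additive (setChrRange K H)ˣ := GrothendieckAddGroup.lift
    (AddMonoidHom.mk' (fun W => Additive.ofMul (isUnit_setChr_chiPlus W).unit) fun V W =>
      Additive.toMul.injective (Units.ext (Subtype.ext (setChr_chiPlus_add V W))))
  have hu : ∀ W, (u (cls W)).toMul = (isUnit_setChr_chiPlus W).unit := fun W =>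
    congrArg Additive.toMul (GrothendieckAddGroup.lift_of _ W)
  choose c hc using fun x => (u x).toMul.1.2
  have hadd : ∀ x y, setChr H (c (x + y)) = setChr H (c x) * setChr H (c y) := by
    intro x y
    refine (hc _).trans (Eq.trans ?_ (congrArg₂ (· * ·) (hc x).symm (hc y).symm))
    rw [map_add]
    rfl
  have hcls : ∀ W, setChr H (c (cls W)) = setChr H (cls (chiPlus H W)) := by
    intro W
    refine (hc _).trans ?_
    rw [hu]
    rfl
  have hzero : setChr H (c 0) = 1 := by
    refine (hc _).trans ?_
    rw [map_zero]
    rfl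
  refine ⟨c, fun W => setChr_injective (hcls W), fun W => setChr_injective ?_,
    fun x y => setChr_injective ?_⟩
  · rw [setChr_vee, ← hcls, ← hadd, add_neg_cancel, hzero, setChr_veeOne]
  · rw [hadd, setChr_vee]

omit [Finite G] in
/-- Two maps from virtual bundles that take sums to products agree if they agree on actual
bundles. -/
theorem eq_of_map_add_eq_mul {R : Type*} [CommMonoid R] {S : Type v} [MulAction G S]
    {a b : KG K G S → R} (ha : ∀ x y, a (x + y) = a x * a y) (hb : ∀ x y, b (x + y) = b x * b y)
    (ha0 : a 0 = 1) (h : ∀ W, a (cls W) = b (cls W)) (x : KG K G S) : a x = b x := by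
  obtain ⟨V, W, rfl⟩ := exists_cls_sub_cls x
  have h1 : a (cls V - cls W) * a (cls W) = a (cls V) := by rw [← ha, sub_add_cancel]
  have h2 : b (cls V - cls W) * b (cls W) = b (cls V) := by rw [← hb, sub_add_cancel]
  have h3 : a (cls W) * a (-cls W) = 1 := by rw [← ha, add_neg_cancel, ha0]
  have h4 : IsUnit (a (cls W)) := IsUnit.of_mul_eq_one _ h3
  rw [← h4.mul_left_inj, h1, h, h, h2]

namespace IsChiExtension

variable {c : KG K G (G ⧸ H) → KG K G (Set (G ⧸ H))} (hc : IsChiExtension H c)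
include hc

theorem setChr_add (x y : KG K G (G ⧸ H)) :
    setChr H (c (x + y)) = setChr H (c x) * setChr H (c y) := by
  rw [hc.add, setChr_vee]

theorem setChr_zero : setChr H (c 0) = 1 := by
  rw [← add_neg_cancel (EquivariantK.cls (0 : KPlus K G (G ⧸ H))), hc.add, hc.cls, hc.neg,
    setChr_veeOne]

theorem unique [CharZero K] {c' : KG K G (G ⧸ H) → KG K G (Set (G ⧸ H))}
    (hc' : IsChiExtension H c') : c' = c := by
  funext x
  refine setChr_injective ?_
  exact eq_of_map_add_eq_mul (a := fun x => setChr H (c' x)) (b := fun x => setChr H (c x))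
    hc'.setChr_add hc.setChr_add hc'.setChr_zero (fun W => by simp only [hc.cls, hc'.cls]) x

end IsChiExtension

/-! ### Characters of `χ` and of the norm on virtual bundles. -/

variable [CharZero K]

theorem isChiExtension_chi : IsChiExtension (K := K) H (chi H) :=
  Classical.epsilon_spec exists_isChiExtension

/-- Both sides take sums to convolution products, the right one by `SetFun.ofProd_add`, so actual
bundles suffice. -/
theorem setChr_chi_of_trivial (x : KG K G (G ⧸ H)) {g : G} (hg : ∀ c : G ⧸ H, g • c = c) :
    setChr H (chi H x) g = SetFun.ofProd fun c => chr (hg c) x := by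
  refine eq_of_map_add_eq_mul (a := fun x => setChr H (chi H x) g)
    (b := fun x => SetFun.ofProd fun c => chr (hg c) x) ?_ ?_ ?_ ?_ x
  · intro x y
    exact congrFun (isChiExtension_chi.setChr_add x y) g
  · intro x y
    simp only [map_add]
    exact SetFun.ofProd_add _ _
  · exact congrFun isChiExtension_chi.setChr_zero g
  · intro W
    simp only [isChiExtension_chi.cls]
    exact setChr_chiPlus_of_trivial W hg

theorem setChr_chi_empty (x : KG K G (G ⧸ H)) (g : G) : setChr H (chi H x) g ∅ = 1 := by
  refine eq_of_map_add_eq_mul (a := fun x => setChr H (chi H x) g ∅) (b := fun _ => 1) ?_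
    (fun _ _ => (one_mul 1).symm) ?_ ?_ x
  · intro x y
    simp only [isChiExtension_chi.setChr_add]
    exact SetFun.mul_empty _ _
  · simp only [isChiExtension_chi.setChr_zero]
    exact if_pos rfl
  · intro W
    simp only [isChiExtension_chi.cls]
    exact setChr_chiPlus_empty W g

omit [CharZero K] in
theorem chr_norm (x : KG K G (G ⧸ H)) {g : G} {o : PUnit.{v + 1}} (ho : g • o = o) :
    chr ho (norm H x) = setChr H (chi H x) g Set.univ :=
  (chr_res (fullPoint H) ho _).trans (setChr_of_smul_eq _ _).symm

theorem norm_cls (W : KPlus K G (G ⧸ H)) : norm H (cls W) = cls (normPlus H W) := by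
  refine ext_chr fun g o ho => ?_
  rw [chr_norm, chr_normPlus, isChiExtension_chi.cls]

/-! ### Normal subgroups of prime index. -/

omit [Finite G] in
theorem smul_coset_eq_iff (hH : H.Normal) {g : G} {c : G ⧸ H} : g • c = c ↔ g ∈ H := by
  refine ⟨fun h => ?_, fun h => smul_coset_eq hH h c⟩
  induction c using QuotientGroup.induction_on with
  | H a =>
    rw [MulAction.Quotient.smul_coe, smul_eq_mul, eq_comm, QuotientGroup.eq] at h
    have := hH.conj_mem _ h a
    simpa [mul_assoc] using this

-- The class of `g` generates the quotient of prime order, so the powers of `g`, which all stabilize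
-- `C`, move any coset to any other.
omit [Finite G] in
theorem eq_empty_or_univ_of_smul_eq (hH : H.Normal) (hp : H.index.Prime) {g : G} (hg : g ∉ H)
    {C : Set (G ⧸ H)} (hC : g • C = C) : C = ∅ ∨ C = Set.univ := by
  rcases C.eq_empty_or_nonempty with h | ⟨c, hc⟩
  · exact Or.inl h
  · right
    have hg1 : (g : G ⧸ H) ≠ 1 := fun h => hg ((QuotientGroup.eq_one_iff g).mp h)
    have := Fact.mk hp
    refine Set.eq_univ_of_forall fun d => ?_
    obtain ⟨n, hn⟩ := mem_zpowers_of_prime_card (p := H.index) (g := (g : G ⧸ H))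
      (g' := d * c⁻¹) H.index_eq_card.symm hg1
    have hs : g ^ n ∈ MulAction.stabilizer G C :=
      Subgroup.zpow_mem _ (MulAction.mem_stabilizer_iff.mpr hC) n
    have h1 : g ^ n • c = d := by
      have h2 : ((g ^ n : G) : G ⧸ H) * c = d := by
        rw [QuotientGroup.mk_zpow]
        exact (congrArg (· * c) hn).trans (inv_mul_cancel_right d c)
      rw [← h2]
      induction c using QuotientGroup.induction_on with
      | H a => rfl
    rw [← MulAction.mem_stabilizer_iff.mp hs, ← h1]
    exact Set.smul_mem_smul_set hc

/-- Over an element outside of `H`, the norm is additive. -/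
theorem setChr_chi_add_univ (hH : H.Normal) (hp : H.index.Prime) {g : G} (hg : g ∉ H)
    (x y : KG K G (G ⧸ H)) : setChr H (chi H (x + y)) g Set.univ =
      setChr H (chi H x) g Set.univ + setChr H (chi H y) g Set.univ := by
  -- Only two splittings contribute, and in each the factor at `∅` is 1.
  rw [isChiExtension_chi.setChr_add, Pi.mul_apply, SetFun.mul_univ, setChr_chi_empty,
    setChr_chi_empty, one_mul, mul_one, add_comm]
  intro D h1 h2
  refine setChr_of_smul_ne (fun h => ?_) _
  exact (eq_empty_or_univ_of_smul_eq hH hp hg h).elim h1 h2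

/-- Additivity is applied to `-x + x = 0`: `χ(0)` is the convolution unit, which is zero on the
nonempty full set. -/
theorem setChr_chi_neg_univ (hH : H.Normal) (hp : H.index.Prime) {g : G} (hg : g ∉ H)
    (x : KG K G (G ⧸ H)) : setChr H (chi H (-x)) g Set.univ =
      -setChr H (chi H x) g Set.univ := by
  rw [eq_neg_iff_add_eq_zero, ← setChr_chi_add_univ hH hp hg, neg_add_cancel,
    isChiExtension_chi.setChr_zero]
  exact if_neg Set.univ_nonempty.ne_empty

omit [Finite G] in
theorem ncard_univ_coset : (Set.univ : Set (G ⧸ H)).ncard = H.index := by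
  rw [Set.ncard_univ, H.index_eq_card]

/-- On `H` the sign comes from the product over `C`. Outside `H`, either `C` is empty with sign 1,
or `C` is everything with sign `-1`, which is `(-1) ^ |C|` because the index is odd. -/
theorem setChr_chi_neg_of_odd (hH : H.Normal) (hp : H.index.Prime) (ho : Odd H.index)
    (x : KG K G (G ⧸ H)) {g : G} {C : Set (G ⧸ H)} (hC : g • C = C) :
    setChr H (chi H (-x)) g C = (-1) ^ C.ncard * setChr H (chi H x) g C := by
  by_cases hg : g ∈ H
  · rw [setChr_chi_of_trivial _ fun c => smul_coset_eq hH hg c,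
      setChr_chi_of_trivial _ fun c => smul_coset_eq hH hg c]
    simp only [SetFun.ofProd, map_neg]
    rw [finprod_mem_eq_finite_toFinset_prod _ (Set.toFinite C),
      finprod_mem_eq_finite_toFinset_prod _ (Set.toFinite C), Finset.prod_neg,
      Set.ncard_eq_toFinset_card C]
  · rcases eq_empty_or_univ_of_smul_eq hH hp hg hC with rfl | rfl
    · rw [setChr_chi_empty, setChr_chi_empty, Set.ncard_empty, pow_zero, one_mul]
    · rw [setChr_chi_neg_univ hH hp hg, ncard_univ_coset, ho.neg_one_pow, neg_one_mul]

theorem fiberAt_chi_neg_of_odd (hH : H.Normal) (hp : H.index.Prime) (ho : Odd H.index)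
    (W : KPlus K G (G ⧸ H)) (C : Set (G ⧸ H)) :
    fiberAt (MulAction.stabilizer G C) C le_rfl (chi H (-cls W)) =
      (-1) ^ C.ncard * fiberAt (MulAction.stabilizer G C) C le_rfl (cls (chiPlus H W)) := by
  refine ext_chr fun s o hs => ?_
  have hC : s.1 • C = C := MulAction.mem_stabilizer_iff.mp s.2
  rw [map_mul, map_pow, map_neg, map_one, chr_fiberAt, chr_fiberAt, ← setChr_of_smul_eq hC,
    ← setChr_of_smul_eq hC, setChr_chi_neg_of_odd hH hp ho _ hC, isChiExtension_chi.cls]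

theorem norm_neg_of_odd (hH : H.Normal) (hp : H.index.Prime) (ho : Odd H.index)
    (W : KPlus K G (G ⧸ H)) : norm H (-cls W) = -cls (normPlus H W) := by
  refine ext_chr fun g o hg => ?_
  rw [map_neg, chr_norm, chr_normPlus, setChr_chi_neg_of_odd hH hp ho _ Set.smul_set_univ,
    ncard_univ_coset, ho.neg_one_pow, neg_one_mul, isChiExtension_chi.cls]

/-! ### Induced characters and subgroups of index two. -/

omit [CharZero K] in
theorem chr_ind_of_mem (hH : H.Normal) [Fintype (G ⧸ H)] (x : KG K G (G ⧸ H)) {g : G}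
    (hg : g ∈ H) {o : PUnit.{v + 1}} (ho : g • o = o) :
    chr ho (ind H x) = ∑ c : G ⧸ H, chr (smul_coset_eq hH hg c) x := by
  rw [ind, chr_push]
  exact Fintype.sum_congr _ _ fun c => dif_pos ⟨rfl, smul_coset_eq hH hg c⟩

omit [CharZero K] in
theorem chr_ind_of_notMem (hH : H.Normal) (x : KG K G (G ⧸ H)) {g : G}
    (hg : g ∉ H) {o : PUnit.{v + 1}} (ho : g • o = o) : chr ho (ind H x) = 0 := by
  have := Fintype.ofFinite (G ⧸ H)
  rw [ind, chr_push]
  exact Finset.sum_eq_zero fun c _ => dif_neg fun h => hg ((smul_coset_eq_iff hH).mp h.2)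

omit [Finite G] [CharZero K] in
theorem chr_translate (hH : H.Normal) (t : G) (W : KPlus K G (G ⧸ H)) {g : G} {c : G ⧸ H}
    (h : g • c = c) (h' : g • (c * (t : G ⧸ H)) = c * (t : G ⧸ H)) :
    chr h (cls (translate hH t W)) = chr h' (cls W) := by
  obtain ⟨W, rfl⟩ := W.exists_mk
  exact (chr_cls_mk h _).trans (chr_cls_mk h' W).symm

omit [Finite G] [CharZero K] in
theorem cls_mul (V W : KPlus K G (G ⧸ H)) : (cls (V * W) : KG K G (G ⧸ H)) = cls V * cls W :=
  (GrothendieckAddGroup.mulHom_of V W).symm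

/-- On `H`, with `a` and `b` the characters of `W` at the two cosets, the identity reads `(-a)(-b) =
-ab + (ab + ba)`, since translation by `t` exchanges the cosets. Outside `H` the norm changes sign
and the induced character vanishes. -/
theorem norm_neg_of_index_two (h2 : H.index = 2) (hH : H.Normal) (W : KPlus K G (G ⧸ H)) {t : G}
    (ht : t ∉ H) : norm H (-cls W) =
      -cls (normPlus H W) + ind H (cls (W * translate hH t W)) := by
  classical
  have := Fintype.ofFinite (G ⧸ H)
  refine ext_chr fun g o hg => ?_
  rw [map_add, map_neg, chr_norm, chr_normPlus, ← isChiExtension_chi.cls]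
  by_cases hgH : g ∈ H
  · have ht1 : (1 : G ⧸ H) ≠ t := fun h => ht ((QuotientGroup.eq_one_iff t).mp h.symm)
    have huniv : (Finset.univ : Finset (G ⧸ H)) = {1, (t : G ⧸ H)} := by
      symm
      rw [← Finset.card_eq_iff_eq_univ, Finset.card_pair ht1, ← Nat.card_eq_fintype_card,
        ← H.index_eq_card, h2]
    have htt : (t : G ⧸ H) * t = 1 := by
      have := Finset.mem_univ ((t : G ⧸ H) * t)
      rw [huniv, Finset.mem_insert, Finset.mem_singleton] at this
      refine this.resolve_right fun h => ht1 ?_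
      exact (mul_eq_left.mp h).symm
    have hsm := fun c => smul_coset_eq hH hgH c
    rw [setChr_chi_of_trivial _ hsm, setChr_chi_of_trivial _ hsm, chr_ind_of_mem hH _ hgH]
    simp only [SetFun.ofProd, Set.mem_univ, finprod_true, finprod_eq_prod_of_fintype, map_neg, cls_mul,
      map_mul, huniv]
    rw [Finset.prod_pair ht1, Finset.prod_pair ht1, Finset.sum_pair ht1,
      chr_translate hH t W (hsm 1) (hsm _), chr_translate hH t W (hsm t) (hsm _)]
    -- The fixed-point proof inside `chr` depends on the coset, so equal cosets are exchanged
    -- through a variable `d`.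
    have e1 : ∀ d : G ⧸ H, d = t → chr (hsm d) (cls W) = chr (hsm t) (cls W) := by
      rintro _ rfl; rfl
    have e2 : ∀ d : G ⧸ H, d = 1 → chr (hsm d) (cls W) = chr (hsm 1) (cls W) := by
      rintro _ rfl; rfl
    rw [e1 _ (one_mul _), e2 _ htt]
    ring
  · rw [chr_ind_of_notMem hH _ hgH, add_zero,
      setChr_chi_neg_univ hH (h2 ▸ Nat.prime_two) hgH]

/-! ### Representations of `H` as bundles, and abelian groups. -/

omit [Finite G] [CharZero K] in
theorem chr_ofRep (x : RepRing K H) {g : G} {c : G ⧸ H} (h : g • c = c) (k : H)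
    (hk : (k : G) = c.out⁻¹ * g * c.out) :
    chr h (ofRep H x) = chr (show k • PUnit.unit.{v + 1} = PUnit.unit from rfl) x := by
  refine addHom_ext (f := (chr h).toAddMonoidHom.comp (ofRep H))
    (f' := (chr (show k • PUnit.unit.{v + 1} = PUnit.unit from rfl)).toAddMonoidHom) ?_ x
  intro W
  obtain ⟨W, rfl⟩ := W.exists_mk
  refine (congrArg (chr h) (GrothendieckAddGroup.mapAdd_of _ _)).trans ?_
  refine (chr_cls_mk h (W.extend H)).trans (Eq.trans ?_ (chr_cls_mk _ W).symm)
  obtain ⟨k, hkH⟩ := k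
  simp only at hk
  subst hk
  rfl

section Abelian

variable (hG : ∀ a b : G, a * b = b * a)
include hG

omit [Finite G] [CharZero K] in
theorem chr_ofRep_of_comm (x : RepRing K H) (k : H) {c : G ⧸ H} (h : (k : G) • c = c) :
    chr h (ofRep H x) = chr (show k • PUnit.unit.{v + 1} = PUnit.unit from rfl) x :=
  chr_ofRep x h k (by rw [mul_assoc, hG k, inv_mul_cancel_left])

omit [Finite G] [CharZero K] in
theorem chr_conj_of_comm (t : G) (x : RepRing K H) (k : H) :
    chr (show k • PUnit.unit.{v + 1} = PUnit.unit from rfl) (conj (normal_of_comm hG) t x) =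
      chr (show k • PUnit.unit.{v + 1} = PUnit.unit from rfl) x := by
  refine (chr_pull _ _ _ x).trans ?_
  have hk : ∀ k' : H, k' = k →
      chr (show k' • PUnit.unit.{v + 1} = PUnit.unit from rfl) x =
        chr (show k • PUnit.unit.{v + 1} = PUnit.unit from rfl) x := by
    rintro _ rfl; rfl
  have := normal_of_comm (H := H) hG
  refine hk _ (Subtype.ext ?_)
  change ((MulAut.conjNormal t⁻¹ k : H) : G) = k
  rw [MulAut.conjNormal_apply, hG t⁻¹, mul_inv_cancel_right]

/-- Elements of `H` fix every coset, and by commutativity they have the same character on all fibres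
of the bundle attached to `x`. -/
theorem chr_fiberAt_chi_ofRep (x : RepRing K H) (C : Set (G ⧸ H)) (k : H) :
    chr (show k • PUnit.unit.{v + 1} = PUnit.unit from rfl)
      (fiberAt H C (le_stabilizer_set (normal_of_comm hG) C) (chi H (ofRep H x))) =
        ∏ᶠ c ∈ C, chr (show k • PUnit.unit.{v + 1} = PUnit.unit from rfl) x := by
  have hsm := fun c => smul_coset_eq (normal_of_comm hG) k.2 c
  rw [chr_fiberAt, ← setChr_of_smul_eq, setChr_chi_of_trivial _ hsm, SetFun.ofProd]
  simp only [chr_ofRep_of_comm hG]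

omit hG [CharZero K] in
theorem finprod_mem_const {R : Type*} [CommMonoid R] (C : Set (G ⧸ H)) (r : R) :
    ∏ᶠ c ∈ C, r = r ^ C.ncard := by
  rw [finprod_mem_eq_finite_toFinset_prod _ (Set.toFinite C), Finset.prod_const,
    Set.ncard_eq_toFinset_card C]

theorem fiberAt_chi_ofRep_eq_finprod (x : RepRing K H) (C : Set (G ⧸ H)) (s : G ⧸ H → G) :
    fiberAt H C (le_stabilizer_set (normal_of_comm hG) C) (chi H (ofRep H x)) =
      ∏ᶠ c ∈ C, conj (normal_of_comm hG) (s c) x := by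
  refine ext_chr fun k o ho => (chr_fiberAt_chi_ofRep hG x C k).trans ?_
  have h1 := (chr ho).toMonoidHom.map_finprod_mem
    (fun c => conj (normal_of_comm hG) (s c) x) (Set.toFinite C)
  refine Eq.trans ?_ h1.symm
  exact finprod_mem_congr rfl fun c _ => (chr_conj_of_comm hG (s c) x k).symm

theorem fiberAt_chi_ofRep_eq_pow (x : RepRing K H) (C : Set (G ⧸ H)) :
    fiberAt H C (le_stabilizer_set (normal_of_comm hG) C) (chi H (ofRep H x)) =
      x ^ C.ncard := by
  refine ext_chr fun k o ho => (chr_fiberAt_chi_ofRep hG x C k).trans ?_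
  rw [finprod_mem_const, map_pow]

theorem chr_repNorm_of_mem (x : RepRing K H) (k : H) {o : PUnit.{v + 1}} (ho : (k : G) • o = o) :
    chr ho (repNorm H x) =
      chr (show k • PUnit.unit.{v + 1} = PUnit.unit from rfl) x ^ H.index := by
  have hsm := fun c => smul_coset_eq (normal_of_comm hG) k.2 c
  rw [repNorm, chr_norm, setChr_chi_of_trivial _ hsm, SetFun.ofProd]
  simp only [chr_ofRep_of_comm hG]
  rw [finprod_mem_const, ncard_univ_coset]

omit [CharZero K] in
theorem chr_repInd_of_mem (x : RepRing K H) (k : H) {o : PUnit.{v + 1}} (ho : (k : G) • o = o) :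
    chr ho (repInd H x) =
      H.index * chr (show k • PUnit.unit.{v + 1} = PUnit.unit from rfl) x := by
  have := Fintype.ofFinite (G ⧸ H)
  rw [repInd, chr_ind_of_mem (normal_of_comm hG) _ k.2]
  simp only [chr_ofRep_of_comm hG]
  rw [Finset.sum_const, nsmul_eq_mul, Finset.card_univ, ← Nat.card_eq_fintype_card,
    H.index_eq_card]

/-- On `H` the norm is the `p`-th power of characters and induction multiplies them by `p`, so the
formula is the binomial expansion of `(x + y) ^ p`. Outside `H` the norm is additive and the induced
terms vanish. -/
theorem repNorm_add (hp : H.index.Prime) (x y : RepRing K H) :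
    repNorm H (x + y) = repNorm H x + repNorm H y +
      ∑ i ∈ Finset.Ico 1 H.index,
        (H.index.choose i / H.index) • repInd H (x ^ i * y ^ (H.index - i)) := by
  refine ext_chr fun g o hg => ?_
  simp only [map_add, map_sum, map_nsmul]
  by_cases hgH : g ∈ H
  · obtain ⟨k, rfl⟩ : ∃ k : H, (k : G) = g := ⟨⟨g, hgH⟩, rfl⟩
    simp only [chr_repNorm_of_mem hG, chr_repInd_of_mem hG, map_add, map_mul, map_pow]
    rw [add_pow, Finset.sum_range_succ, Finset.range_eq_Ico,
      Finset.sum_eq_sum_Ico_succ_bot hp.pos]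
    -- The division of natural numbers is exact, since a prime `p` divides `p.choose i` for `0 < i <
    -- p`.
    have h : ∀ i ∈ Finset.Ico 1 H.index, ∀ a : K,
        (H.index.choose i / H.index) • (H.index * a) = a * H.index.choose i := by
      intro i hi a
      rw [Finset.mem_Ico] at hi
      obtain ⟨m, hm⟩ := hp.dvd_choose_self (by omega) hi.2
      rw [hm, Nat.mul_div_cancel_left m hp.pos, nsmul_eq_mul, Nat.cast_mul]
      ring
    rw [Finset.sum_congr rfl fun i hi => h i hi _]
    simp
    ring
  · have hH := normal_of_comm (H := H) hG
    simp only [repNorm, repInd, chr_norm, chr_ind_of_notMem hH _ hgH, map_add,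
      setChr_chi_add_univ hH hp hgH, smul_zero, Finset.sum_const_zero, add_zero]

end Abelian

end

end EquivariantK

/-! ### The theorem. -/

open EquivariantK in
theorem mainTheorem11 {K : Type u} [Field K] [CharZero K] {G : Type v} [Group G] [Finite G]
    (H : Subgroup G) :
    -- the extension of `χ` to virtual bundles exists and is unique, and it extends the norm
    (∃! c : KG K G (G ⧸ H) → KG K G (Set (G ⧸ H)), IsChiExtension H c) ∧
    (∀ W : KPlus K G (G ⧸ H), norm H (cls W) = cls (normPlus H W)) ∧
    -- normal subgroups of odd prime index
    (H.Normal → H.index.Prime → Odd H.index → ∀ W : KPlus K G (G ⧸ H),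
      (∀ C : Set (G ⧸ H),
        fiberAt (MulAction.stabilizer G C) C le_rfl (chi H (-cls W)) =
          (-1) ^ C.ncard * fiberAt (MulAction.stabilizer G C) C le_rfl (cls (chiPlus H W))) ∧
      norm H (-cls W) = -cls (normPlus H W)) ∧
    -- subgroups of index two
    (∀ h2 : H.index = 2, ∀ W : KPlus K G (G ⧸ H), ∀ t : G, t ∉ H →
      norm H (-cls W) = -cls (normPlus H W) +
        ind H (cls (W * translate (Subgroup.normal_of_index_eq_two h2) t W))) ∧
    -- abelian groups
    (∀ hG : ∀ a b : G, a * b = b * a, H.index.Prime →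
      (∀ (x : RepRing K H) (C : Set (G ⧸ H)), C ≠ Set.univ →
        (∀ s : G ⧸ H → G, (∀ c, (s c : G ⧸ H) = c) →
          fiberAt H C (le_stabilizer_set (normal_of_comm hG) C) (chi H (ofRep H x)) =
            ∏ᶠ c ∈ C, conj (normal_of_comm hG) (s c) x) ∧
        fiberAt H C (le_stabilizer_set (normal_of_comm hG) C) (chi H (ofRep H x)) =
          x ^ C.ncard) ∧
      (∀ x y : RepRing K H,
        repNorm H (x + y) = repNorm H x + repNorm H y +
          ∑ i ∈ Finset.Ico 1 H.index,
            (H.index.choose i / H.index) • repInd H (x ^ i * y ^ (H.index - i)))) := by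
  obtain ⟨c, hc⟩ := exists_isChiExtension (K := K) (H := H)
  refine ⟨⟨c, hc, fun c' hc' => hc.unique hc'⟩, norm_cls, fun hH hp ho W =>
    ⟨fiberAt_chi_neg_of_odd hH hp ho W, norm_neg_of_odd hH hp ho W⟩,
    fun h2 W t ht => norm_neg_of_index_two h2 _ W ht, fun hG hp => ⟨fun x C _ =>
      ⟨fun s _ => fiberAt_chi_ofRep_eq_finprod hG x C s, fiberAt_chi_ofRep_eq_pow hG x C⟩,
      repNorm_add hG hp⟩⟩
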